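/- Let $R$ be a commutative unital ring and let $G$ be a hypertree on a finite vertex set $V$: a connected (bidirected, simple) graph each of whose strong blocks (maximal connected subgraphs without cut-vertices) is a complete graph. Let $E$ index the strong blocks, let $p_e$ be the number of vertices of block $e$, and identify its vertex set with $[p_e]=\{1,\dots,p_e\}$ (in any order). For each $e\in E$ let $a_e\in R$ and $m_{e,v},m'_{e,v}\in R$ ($v\in[p_e]$) be given, and let $D^*_{G_e}$ be the $p_e\times p_e$ matrix with $(i,j)$ entry $m_{e,i}m'_{e,j}$ if $i\ne j$ and $1$ if $i=j$. Define $D^*_G=(m_{ij})_{i,j\in V}$ and $D_{\mathcal G}=(d_{ij})_{i,j\in V}$ as follows. If $i,j$ lie in a common block $e$, then $m_{ij}=(D^*_{G_e})_{ij}$ and $d_{ij}=a_e(m_{ij}-1)$. Otherwise, choose any cut-vertex $v\neq i,j$ through which every path from $i$ to $j$ passes, and recursively put $m_{ij}=m_{iv}m_{vj}$ and $d_{ij}=d_{iv}+m_{iv}d_{vj}$. For $v_0\in V$ let $$\kappa(D_{\mathcal G},v_0)=\det\bigl(d_{ij}-d_{iv_0}-m_{iv_0}d_{v_0j}\bigr)_{i,j\in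 V\setminus\{v_0\}},$$ and for a square matrix $A$ let $\operatorname{cof}(A)$ be the sum of all its cofactors, i.e. of all entries of its adjugate. For $e\in E$ put $$\mathbf d_e=\Bigl(\frac{m_{e,v}m'_{e,v}}{1-m_{e,v}m'_{e,v}}\Bigr)_{v\in[p_e]},\qquad \mathbf e(p_e)=(1,\dots,1)^T\in R^{p_e},$$ $$S_e=p_e-1+\sum_{v<w\in[p_e]}\frac{(m_{e,v}-m_{e,w})(m'_{e,v}-m'_{e,w})}{(1-m_{e,v}m'_{e,v})(1-m_{e,w}m'_{e,w})}.$$ Then $\kappa(D_{\mathcal G},v_0)=:\kappa(D_{\mathcal G})$ does not depend on $v_0$, and $$\kappa(D_{\mathcal G})=\prod_{e\in E}\Bigl(a_e^{p_e-1}\bigl(1+\mathbf e(p_e)^T\mathbf d_e\bigr)\prod_{v\in[p_e]}(1-m_{e,v}m'_{e,v})\Bigr),$$ $$\det(D_{\mathcal G})=\kappa(D_{\mathcal G})\sum_{e\in E}\frac{-a_e\,S_e}{1+\mathbf e(p_e)^T\mathbf d_e},\qquad \operatorname{cof}(D_{\mathcal G})=\kappa(D_{\mathcal G})\Bigl(1+\sum_{e\in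 E}\frac{S_e}{1+\mathbf e(p_e)^T\mathbf d_e}\Bigr).$$ The denominators are placeholders, to be cancelled against factors of the products. That is: the formulas hold as written whenever the denominators occurring in them are units of $R$; and for all values of the data in $R$ they hold after cancellation, namely, with $$P_e=\prod_{v}(1-m_{e,v}m'_{e,v})+\sum_{v}m_{e,v}m'_{e,v}\prod_{w\ne v}(1-m_{e,w}m'_{e,w}),$$ $$Q_e=(p_e-1)\prod_{v}(1-m_{e,v}m'_{e,v})+\sum_{v<w}(m_{e,v}-m_{e,w})(m'_{e,v}-m'_{e,w})\prod_{u\ne v,w}(1-m_{e,u}m'_{e,u})$$ (all indices in $[p_e]$), one has $$\kappa(D_{\mathcal G})=\prod_{e\in E}a_e^{p_e-1}P_e,\qquad \det(D_{\mathcal G})=\sum_{e\in E}\bigl(-a_e\cdot a_e^{p_e-1}Q_e\bigr)\prod_{f\ne e}a_f^{p_f-1}P_f,$$ $$\operatorname{cof}(D_{\mathcal G})=\prod_{e\in E}a_e^{p_e-1}P_e+\sum_{e\in E}a_e^{p_e-1}Q_e\prod_{f\ne e}a_f^{p_f-1}P_f.$$ -/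

import Mathlib

/-! Undirected simple graphs stand for bidirected graphs. -/

namespace SimpleGraph

variable {V : Type*}

/-- `B` induces a connected subgraph of `G` which has no cut-vertex, that is, in which the removal
of any one vertex leaves no two remaining vertices disconnected. -/
def NoCutVertex (G : SimpleGraph V) (B : Finset V) : Prop :=
  (G.induce (B : Set V)).Connected ∧
    ∀ v ∈ B, (G.induce ((B : Set V) \ {v})).Preconnected

/-- A strong block: a maximal (connected) subgraph without cut-vertices. Such a subgraph is
induced, so it is given by its vertex set. -/
def IsStrongBlock (G : SimpleGraph V) (B : Finset V) : Prop :=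
  Maximal G.NoCutVertex B

/-- The index set `E` of the strong blocks of `G`. -/
abbrev StrongBlock (G : SimpleGraph V) : Type _ :=
  {B : Finset V // G.IsStrongBlock B}

noncomputable instance StrongBlock.instFintype [Fintype V] (G : SimpleGraph V) :
    Fintype G.StrongBlock :=
  Fintype.ofFinite _

/-- A hypertree: a connected graph all of whose strong blocks are cliques. -/
def IsHypertree (G : SimpleGraph V) : Prop :=
  G.Connected ∧ ∀ e : G.StrongBlock, G.IsClique (e.1 : Set V)

/-- `v` lies strictly between `i` and `j`: there is a walk from `i` to `j`, and each such walk
passes through `v`, which is neither `i` nor `j`. In particular `v` is a cut-vertex. -/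
def Separates (G : SimpleGraph V) (v i j : V) : Prop :=
  v ≠ i ∧ v ≠ j ∧ G.Reachable i j ∧ ∀ p : G.Walk i j, v ∈ p.support

theorem Separates.symm {G : SimpleGraph V} {v i j : V} (h : G.Separates v i j) :
    G.Separates v j i :=
  ⟨h.2.1, h.1, h.2.2.1.symm, fun p => by simpa using h.2.2.2 p.reverse⟩

theorem Separates.dist_left_lt {G : SimpleGraph V} {v i j : V} (h : G.Separates v i j) :
    G.dist i v < G.dist i j := by
  classical
  obtain ⟨p, hp⟩ := h.2.2.1.exists_walk_length_eq_dist
  have hv := h.2.2.2 p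
  rw [← hp]
  exact (dist_le (p.takeUntil v hv)).trans_lt (p.length_takeUntil_lt_length hv h.2.1)

theorem Separates.dist_right_lt {G : SimpleGraph V} {v i j : V} (h : G.Separates v i j) :
    G.dist v j < G.dist i j := by
  have := h.symm.dist_left_lt
  rwa [dist_comm, G.dist_comm (u := j) (v := i)] at this

/-- An additive-multiplicative block-datum on `G` over `R`: for each strong block `e` a scalar
`a e` and a square matrix `mat e`, indexed by the vertices of `e`, with diagonal entries `1`. -/
structure BlockDatum (G : SimpleGraph V) (R : Type*) [CommRing R] where
  a : G.StrongBlock → R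
  mat : ∀ e : G.StrongBlock, Matrix e.1 e.1 R
  mat_diag : ∀ e v, mat e v v = 1

namespace BlockDatum

variable {G : SimpleGraph V} {R : Type*} [CommRing R]

open Classical in
/-- Entry `m i j` of the multiplicative distance matrix: the entry of the block matrix if `i` and
`j` lie in a common strong block, and otherwise `m i v * m v j` for a cut-vertex `v` between
`i` and `j`. (The value `0` is never taken when `G` is connected.) -/
noncomputable def multDist (𝒢 : G.BlockDatum R) (i j : V) : R :=
  if h : ∃ e : G.StrongBlock, i ∈ e.1 ∧ j ∈ e.1 then
    𝒢.mat h.choose ⟨i, h.choose_spec.1⟩ ⟨j, h.choose_spec.2⟩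
  else if h : ∃ v, G.Separates v i j then
    multDist 𝒢 i h.choose * multDist 𝒢 h.choose j
  else 0
termination_by G.dist i j
decreasing_by
  · exact h.choose_spec.dist_left_lt
  · exact h.choose_spec.dist_right_lt

open Classical in
/-- Entry `d i j` of the additive-multiplicative distance matrix: `a e * (m i j - 1)` if `i` and
`j` lie in a common strong block `e`, and otherwise `d i v + m i v * d v j` for a cut-vertex `v`
between `i` and `j`. -/
noncomputable def addMultDist (𝒢 : G.BlockDatum R) (i j : V) : R :=
  if h : ∃ e : G.StrongBlock, i ∈ e.1 ∧ j ∈ e.1 then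
    𝒢.a h.choose * (𝒢.mat h.choose ⟨i, h.choose_spec.1⟩ ⟨j, h.choose_spec.2⟩ - 1)
  else if h : ∃ v, G.Separates v i j then
    addMultDist 𝒢 i h.choose + 𝒢.multDist i h.choose * addMultDist 𝒢 h.choose j
  else 0
termination_by G.dist i j
decreasing_by
  · exact h.choose_spec.dist_left_lt
  · exact h.choose_spec.dist_right_lt

/-- The additive-multiplicative distance matrix of the block-datum. -/
noncomputable def distMatrix (𝒢 : G.BlockDatum R) : Matrix V V R :=
  Matrix.of fun i j => 𝒢.addMultDist i j

/-- The invariant `κ` at the vertex `v₀`: the determinant of `D' - u eᵀ - m wᵀ` over the vertices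
other than `v₀`, where `D'` is the corresponding principal submatrix of the
additive-multiplicative distance matrix, `u` and `wᵀ` are its column and row at `v₀`, and `m` is
the column at `v₀` of the multiplicative distance matrix. -/
noncomputable def kappa [Fintype V] [DecidableEq V] (𝒢 : G.BlockDatum R) (v₀ : V) : R :=
  Matrix.det (Matrix.of fun i j : {v : V // v ≠ v₀} =>
    𝒢.addMultDist i j - 𝒢.addMultDist i v₀ - 𝒢.multDist i v₀ * 𝒢.addMultDist v₀ j)

open Classical in
/-- The block-datum in which the entry `i → j` of the matrix of block `e` is `m e i * m' e j` for
`i ≠ j`, and `1` for `i = j`. -/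
noncomputable def ofCliques (a : G.StrongBlock → R) (m m' : ∀ e : G.StrongBlock, e.1 → R) :
    G.BlockDatum R where
  a := a
  mat e := Matrix.of fun i j => if i = j then 1 else m e i * m' e j
  mat_diag e v := by simp

end BlockDatum

end SimpleGraph

namespace Matrix

/-- The cofactor-sum of a square matrix: the sum of the entries of its adjugate. -/
def cofactorSum {ι R : Type*} [Fintype ι] [DecidableEq ι] [CommRing R] (A : Matrix ι ι R) : R :=
  ∑ i, ∑ j, A.adjugate i j

end Matrix

/-! Quantities attached to one clique with vertex set `ι` and data `m`, `m'`. Below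
`δ v = 1 - m v * m' v`. The fractional ones are meaningful when the denominators are units;
the cleared ones are their products with `∏ v, δ v`, with the denominators cancelled
symbolically, and make sense over any commutative ring. -/

namespace CliqueData

variable {ι R : Type*} [Fintype ι] [LinearOrder ι] [CommRing R]

/-- The entry `m v * m' v / (1 - m v * m' v)` of the vector `d`. -/
noncomputable def dVec (m m' : ι → R) (v : ι) : R :=
  m v * m' v * Ring.inverse (1 - m v * m' v)

/-- `1 + eᵀ d`. -/
noncomputable def onePlus (m m' : ι → R) : R :=
  1 + ∑ v, dVec m m' v

/-- `p - 1 + ∑_{v < w} (m v - m w) (m' v - m' w) / ((1 - m v * m' v) (1 - m w * m' w))`. -/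
noncomputable def pairSum (m m' : ι → R) : R :=
  (Fintype.card ι : R) - 1 +
    ∑ x : ι × ι with x.1 < x.2, (m x.1 - m x.2) * (m' x.1 - m' x.2) *
      Ring.inverse ((1 - m x.1 * m' x.1) * (1 - m x.2 * m' x.2))

/-- `(∏ v, δ v) * (1 + eᵀ d)` with denominators cancelled. -/
def onePlusCleared (m m' : ι → R) : R :=
  ∏ v, (1 - m v * m' v) + ∑ v, m v * m' v * ∏ w with w ≠ v, (1 - m w * m' w)

/-- `(∏ v, δ v) * pairSum` with denominators cancelled. -/
def pairSumCleared (m m' : ι → R) : R :=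
  ((Fintype.card ι : R) - 1) * ∏ v, (1 - m v * m' v) +
    ∑ x : ι × ι with x.1 < x.2, (m x.1 - m x.2) * (m' x.1 - m' x.2) *
      ∏ u with u ≠ x.1 ∧ u ≠ x.2, (1 - m u * m' u)

end CliqueData

open SimpleGraph CliqueData

open SimpleGraph CliqueData

namespace SimpleGraph

variable {V : Type*} {G : SimpleGraph V}

/-- Some walk from `v` to `w` does not pass through `u`. -/
def Avoids (G : SimpleGraph V) (u v w : V) : Prop :=
  ∃ p : G.Walk v w, u ∉ p.support

theorem Avoids.symm {u v w : V} (h : G.Avoids u v w) : G.Avoids u w v := by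
  obtain ⟨p, hp⟩ := h
  exact ⟨p.reverse, by simpa using hp⟩

theorem Avoids.trans {u v w x : V} (h : G.Avoids u v w) (h' : G.Avoids u w x) :
    G.Avoids u v x := by
  obtain ⟨p, hp⟩ := h
  obtain ⟨q, hq⟩ := h'
  exact ⟨p.append q, by simp [Walk.mem_support_append_iff, hp, hq]⟩

theorem Adj.avoids {u v w : V} (h : G.Adj v w) (hv : u ≠ v) (hw : u ≠ w) : G.Avoids u v w :=
  ⟨h.toWalk, by simp [hv, hw]⟩

theorem Connected.avoids_of_dist_le (hG : G.Connected) {u v w : V} (huw : u ≠ w)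
    (h : G.dist v w ≤ G.dist v u) : G.Avoids u v w := by
  classical
  obtain ⟨p, hp⟩ := hG.exists_walk_length_eq_dist v w
  refine ⟨p, fun hu => ?_⟩
  have h1 := G.dist_le (p.takeUntil u hu)
  have h2 := p.length_takeUntil_lt_length hu huw
  omega

theorem Connected.dist_lt_of_not_avoids (hG : G.Connected) {u v w : V} (huw : u ≠ w)
    (h : ¬ G.Avoids u v w) : G.dist v u < G.dist v w := by
  by_contra h'
  exact h (hG.avoids_of_dist_le huw (not_lt.1 h'))

theorem Connected.exists_adj_dist_lt (hG : G.Connected) {u v : V} (huv : u ≠ v) :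
    ∃ y, G.Adj y v ∧ G.dist u y < G.dist u v := by
  obtain ⟨p, hp⟩ := hG.exists_walk_length_eq_dist v u
  cases p with
  | nil => exact absurd rfl huv
  | @cons _ y _ h q =>
    refine ⟨y, h.symm, ?_⟩
    have := G.dist_le q
    rw [G.dist_comm (u := u), G.dist_comm (u := u)]
    simp at hp
    omega

theorem IsClique.noCutVertex {B : Finset V} (hB : B.Nonempty) (h : G.IsClique (B : Set V)) :
    G.NoCutVertex B := by
  have key : ∀ s : Set V, G.IsClique s → (G.induce s).Preconnected := by
    rintro s hs ⟨x, hx⟩ ⟨y, hy⟩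
    by_cases hxy : x = y
    · subst hxy; rfl
    · exact Adj.reachable (induce_adj.2 (hs hx hy hxy))
  obtain ⟨b, hb⟩ := hB
  have : Nonempty (B : Set V) := ⟨⟨b, hb⟩⟩
  exact ⟨⟨key _ h⟩, fun v _ => key _ (h.subset Set.sdiff_subset)⟩

theorem noCutVertex_of_path [DecidableEq V] {x y z : V} (hxy : G.Adj x y) (hyz : G.Adj y z)
    (p : G.Walk x z) (hp : p.IsPath) (hy : y ∉ p.support) :
    G.NoCutVertex (insert y p.support.toFinset) := by
  have mem : ∀ {v}, v ∈ ((insert y p.support.toFinset : Finset V) : Set V) ↔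
      v = y ∨ v ∈ p.support := by simp
  have key : ∀ v ≠ y, ∀ u ∈ p.support, ∀ hu : u ≠ v,
      ∃ q : G.Walk u y, ∀ w ∈ q.support,
        w ∈ ((insert y p.support.toFinset : Finset V) : Set V) \ {v} := by
    intro v hvy u hu huv
    by_cases hv : v ∈ (p.takeUntil u hu).support
    · have hv' : v ∉ (p.dropUntil u hu).support := by
        intro hv'
        have h := p.take_spec hu
        rw [← h] at hp
        exact hp.ne_of_mem_support_of_append huv.symm hv hv' rfl
      refine ⟨(p.dropUntil u hu).append hyz.symm.toWalk, fun w hw => ?_⟩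
      rw [Walk.mem_support_append_iff] at hw
      rcases hw with hw | hw
      · exact ⟨mem.2 (Or.inr (p.support_dropUntil_subset_support hu hw)),
          fun h => hv' (h ▸ hw)⟩
      · simp at hw
        rcases hw with rfl | rfl
        · exact ⟨mem.2 (Or.inr p.end_mem_support), fun h => hv' (by
            rw [← Set.mem_singleton_iff.1 h]; exact Walk.end_mem_support _)⟩
        · exact ⟨mem.2 (Or.inl rfl), fun h => hvy h.symm⟩
    · refine ⟨(p.takeUntil u hu).reverse.append hxy.toWalk, fun w hw => ?_⟩
      rw [Walk.mem_support_append_iff] at hw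
      rcases hw with hw | hw
      · simp only [Walk.support_reverse, List.mem_reverse] at hw
        exact ⟨mem.2 (Or.inr (p.support_takeUntil_subset_support hu hw)),
          fun h => hv (h ▸ hw)⟩
      · simp at hw
        rcases hw with rfl | rfl
        · exact ⟨mem.2 (Or.inr p.start_mem_support), fun h => hv (by
            rw [← Set.mem_singleton_iff.1 h]; exact Walk.start_mem_support _)⟩
        · exact ⟨mem.2 (Or.inl rfl), fun h => hvy h.symm⟩
  have pathpre : (G.induce {v | v ∈ p.support}).Preconnected := by
    have : ∀ u : {v | v ∈ p.support}, (G.induce {v | v ∈ p.support}).Reachable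
        ⟨x, p.start_mem_support⟩ u := fun ⟨u, hu⟩ =>
      ⟨(p.takeUntil u hu).induce _ fun w hw => p.support_takeUntil_subset_support hu hw⟩
    exact fun a b => (this a).symm.trans (this b)
  refine ⟨⟨?_⟩, fun v hv => ?_⟩
  · have : ∀ u : ((insert y p.support.toFinset : Finset V) : Set V),
        (G.induce ((insert y p.support.toFinset : Finset V) : Set V)).Reachable u
          ⟨y, mem.2 (Or.inl rfl)⟩ := by
      rintro ⟨u, hu⟩
      rcases mem.1 hu with rfl | hu
      · rfl
      · refine ⟨((p.takeUntil u hu).reverse.append hxy.toWalk).induce _ fun w hw => ?_⟩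
        rw [Walk.mem_support_append_iff] at hw
        rcases hw with hw | hw
        · simp only [Walk.support_reverse, List.mem_reverse] at hw
          exact mem.2 (Or.inr (p.support_takeUntil_subset_support hu hw))
        · simp at hw
          rcases hw with rfl | rfl
          · exact mem.2 (Or.inr p.start_mem_support)
          · exact mem.2 (Or.inl rfl)
    exact fun a b => (this a).trans (this b).symm
  · by_cases hvy : v = y
    · subst hvy
      have : ((insert v p.support.toFinset : Finset V) : Set V) \ {v} = {w | w ∈ p.support} := by
        ext w
        simp only [Set.mem_sdiff, mem, Set.mem_singleton_iff, Set.mem_ofPred_eq]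
        constructor
        · tauto
        · intro h
          exact ⟨Or.inr h, fun h' => hy (h' ▸ h)⟩
      rw [this]
      exact pathpre
    · have hy' : y ∈ ((insert y p.support.toFinset : Finset V) : Set V) \ {v} :=
        ⟨mem.2 (Or.inl rfl), fun h => hvy h.symm⟩
      have : ∀ u : (((insert y p.support.toFinset : Finset V) : Set V) \ {v} : Set V),
          (G.induce (((insert y p.support.toFinset : Finset V) : Set V) \ {v})).Reachable u
            ⟨y, hy'⟩ := by
        rintro ⟨u, hu, huv⟩
        rcases mem.1 hu with rfl | hu
        · rfl
        · obtain ⟨q, hq⟩ := key v hvy u hu huv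
          exact ⟨q.induce _ hq⟩
      exact fun a b => (this a).trans (this b).symm

theorem NoCutVertex.exists_strongBlock [Finite V] {B : Finset V} (hB : G.NoCutVertex B) :
    ∃ e : G.StrongBlock, B ⊆ e.1 := by
  obtain ⟨C, hBC, hC⟩ := Finite.exists_le_maximal hB
  exact ⟨⟨C, hC⟩, hBC⟩

theorem StrongBlock.nonempty (e : G.StrongBlock) : e.1.Nonempty := by
  obtain ⟨⟨b, hb⟩⟩ := e.2.prop.1.nonempty
  exact ⟨b, hb⟩

theorem StrongBlock.eq_of_subset {e : G.StrongBlock} {B : Finset V}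
    (hB : G.NoCutVertex B) (h : e.1 ⊆ B) : e.1 = B :=
  Finset.Subset.antisymm h (e.2.le_of_ge hB h)

theorem exists_strongBlock_mem [Finite V] (v : V) : ∃ e : G.StrongBlock, v ∈ e.1 := by
  obtain ⟨e, he⟩ := (IsClique.noCutVertex (G := G) (B := {v}) (by simp) (by simp)).exists_strongBlock
  exact ⟨e, he (by simp)⟩

theorem Adj.exists_strongBlock [Finite V] {v w : V} (h : G.Adj v w) :
    ∃ e : G.StrongBlock, v ∈ e.1 ∧ w ∈ e.1 := by
  classical
  obtain ⟨e, he⟩ := (IsClique.noCutVertex (G := G) (B := {v, w}) (by simp) (by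
    simp [SimpleGraph.IsClique, h])).exists_strongBlock
  exact ⟨e, he (by simp), he (by simp)⟩

end SimpleGraph

namespace SimpleGraph

variable {V : Type*} {G : SimpleGraph V}

namespace IsHypertree

theorem adj_of_mem (hG : G.IsHypertree) {e : G.StrongBlock} {v w : V} (hv : v ∈ e.1)
    (hw : w ∈ e.1) (h : v ≠ w) : G.Adj v w :=
  hG.2 e hv hw h

theorem eq_or_adj_of_avoids [Finite V] (hG : G.IsHypertree) {x y z : V} (hxy : G.Adj x y) (hyz : G.Adj y z)
    (h : G.Avoids y x z) : x = z ∨ G.Adj x z := by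
  classical
  obtain ⟨p, hp⟩ := h
  obtain ⟨e, he⟩ := (noCutVertex_of_path hxy hyz p.bypass p.bypass_isPath
    fun h => hp (p.support_bypass_subset_support h)).exists_strongBlock
  refine or_iff_not_imp_left.2 fun hxz => hG.adj_of_mem (e := e) (he ?_) (he ?_) hxz
  · simp
  · simp

theorem mem_of_forall_adj (hG : G.IsHypertree) {e : G.StrongBlock} {y : V}
    (h : ∀ w ∈ e.1, y = w ∨ G.Adj y w) : y ∈ e.1 := by
  classical
  have hc : G.NoCutVertex (insert y e.1) := by
    refine IsClique.noCutVertex (by simp) ?_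
    rw [Finset.coe_insert]
    refine (hG.2 e).insert fun w hw hne => ?_
    exact (h w hw).resolve_left hne
  rw [StrongBlock.eq_of_subset hc (Finset.subset_insert y e.1)]
  simp

variable [Finite V]

theorem strongBlock_eq (hG : G.IsHypertree) {e f : G.StrongBlock} {u v : V} (huv : u ≠ v)
    (hue : u ∈ e.1) (hve : v ∈ e.1) (huf : u ∈ f.1) (hvf : v ∈ f.1) : e = f := by
  have key : ∀ {e f : G.StrongBlock}, u ∈ e.1 → v ∈ e.1 → u ∈ f.1 → v ∈ f.1 → e.1 ⊆ f.1 := by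
    intro e f hue hve huf hvf x hx
    refine hG.mem_of_forall_adj fun y hy => ?_
    by_cases hxu : x = u
    · subst hxu
      exact or_iff_not_imp_left.2 fun hne => hG.adj_of_mem huf hy hne
    by_cases hyu : y = u
    · subst hyu
      exact or_iff_not_imp_left.2 fun hne => hG.adj_of_mem hx hue hne
    refine hG.eq_or_adj_of_avoids (hG.adj_of_mem hx hue hxu)
      (hG.adj_of_mem huf hy (Ne.symm hyu)) ?_
    have hxv : G.Avoids u x v := by
      by_cases hxv : x = v
      · subst hxv; exact ⟨Walk.nil, by simpa using huv⟩
      · exact (hG.adj_of_mem hx hve hxv).avoids (Ne.symm hxu) huv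
    have hvy : G.Avoids u v y := by
      by_cases hvy : v = y
      · subst hvy; exact ⟨Walk.nil, by simpa using huv⟩
      · exact (hG.adj_of_mem hvf hy hvy).avoids huv (Ne.symm hyu)
    exact hxv.trans hvy
  exact Subtype.ext (Finset.Subset.antisymm (key hue hve huf hvf) (key huf hvf hue hve))

theorem exists_gate (hG : G.IsHypertree) (e : G.StrongBlock) (v : V) :
    ∃ g ∈ e.1, ∀ w ∈ e.1, ¬ G.Avoids g v w := by
  classical
  by_cases hv : v ∈ e.1
  · exact ⟨v, hv, fun w _ ⟨p, hp⟩ => hp p.start_mem_support⟩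
  obtain ⟨u, hu, hmin⟩ := e.1.exists_min_image (fun u => G.dist v u) e.nonempty
  refine ⟨u, hu, fun w hw hav => hv ?_⟩
  have hwu : w ≠ u := by
    rintro rfl
    obtain ⟨p, hp⟩ := hav
    exact hp p.end_mem_support
  have hvu : v ≠ u := fun h => hv (h ▸ hu)
  obtain ⟨y, hyu, hlt⟩ := hG.1.exists_adj_dist_lt hvu
  have hye : y ∉ e.1 := fun hy => absurd (hmin y hy) (not_le.2 hlt)
  have hyw : G.Avoids u y w :=
    (hG.1.avoids_of_dist_le hyu.ne.symm hlt.le).symm.trans hav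
  refine absurd (hG.mem_of_forall_adj fun w' hw' => ?_) hye
  by_cases hw'u : w' = u
  · subst hw'u; exact Or.inr hyu
  · refine hG.eq_or_adj_of_avoids hyu (hG.adj_of_mem hu hw' (Ne.symm hw'u)) ?_
    by_cases hww' : w = w'
    · rwa [← hww']
    · exact hyw.trans ((hG.adj_of_mem hw hw' hww').avoids hwu.symm (Ne.symm hw'u))

/-- The gate of `v` in the block `e`: the vertex through which every walk from `v` enters `e`. -/
noncomputable def gate (hG : G.IsHypertree) (e : G.StrongBlock) (v : V) : V :=
  (hG.exists_gate e v).choose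

theorem gate_mem (hG : G.IsHypertree) (e : G.StrongBlock) (v : V) : hG.gate e v ∈ e.1 :=
  (hG.exists_gate e v).choose_spec.1

theorem not_avoids_gate (hG : G.IsHypertree) {e : G.StrongBlock} (v : V) {w : V} (hw : w ∈ e.1) :
    ¬ G.Avoids (hG.gate e v) v w :=
  (hG.exists_gate e v).choose_spec.2 w hw

theorem gate_of_mem (hG : G.IsHypertree) {e : G.StrongBlock} {v : V} (hv : v ∈ e.1) :
    hG.gate e v = v := by
  by_contra h
  exact hG.not_avoids_gate v hv ⟨Walk.nil, by simpa using h⟩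

theorem mem_of_adj_of_gate_ne (hG : G.IsHypertree) {e : G.StrongBlock} {x y : V}
    (h : G.Adj x y) (hne : hG.gate e x ≠ hG.gate e y) : x ∈ e.1 := by
  by_cases hx : hG.gate e x = x
  · rw [← hx]; exact hG.gate_mem e x
  have hy : hG.gate e x ≠ y := by
    intro hy
    have : y ∈ e.1 := hy ▸ hG.gate_mem e x
    exact hne (hy.trans (hG.gate_of_mem this).symm)
  have h1 : ¬ G.Avoids (hG.gate e x) y (hG.gate e y) := fun h2 =>
    hG.not_avoids_gate x (hG.gate_mem e y) ((h.avoids hx hy).trans h2)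
  have h2 := hG.1.dist_lt_of_not_avoids hne h1
  have h3 := hG.1.dist_lt_of_not_avoids hne.symm (hG.not_avoids_gate y (hG.gate_mem e x))
  omega

theorem gate_not_avoids (hG : G.IsHypertree) {e : G.StrongBlock} {v w : V}
    (hne : hG.gate e v ≠ hG.gate e w) : ¬ G.Avoids (hG.gate e v) v w := by
  rintro ⟨p, hp⟩
  apply hp
  clear hp
  induction p with
  | nil => exact absurd rfl hne
  | @cons v x w h p ih =>
    by_cases hvx : hG.gate e v = hG.gate e x
    · rw [hvx] at hne ⊢
      simp [ih hne]
    · rw [hG.gate_of_mem (hG.mem_of_adj_of_gate_ne h hvx)]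
      simp

theorem gate_eq_gate (hG : G.IsHypertree) {e f : G.StrongBlock} (hef : e ≠ f) {x y : V}
    (hx : x ∈ f.1) (hy : y ∈ f.1) : hG.gate e x = hG.gate e y := by
  by_contra h
  have hxy : x ≠ y := fun h' => h (h' ▸ rfl)
  have hadj := hG.adj_of_mem hx hy hxy
  exact hef (hG.strongBlock_eq hxy (hG.mem_of_adj_of_gate_ne hadj h)
    (hG.mem_of_adj_of_gate_ne hadj.symm (Ne.symm h)) hx hy)

/-- Every vertex lies on the side of `f` with respect to `e`, or on the side of `e` with respect
to `f`. -/
theorem gate_eq_or_gate_eq (hG : G.IsHypertree) {e f : G.StrongBlock} (hef : e ≠ f) {x y : V}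
    (hx : x ∈ e.1) (hy : y ∈ f.1) (v : V) :
    hG.gate e v = hG.gate e y ∨ hG.gate f v = hG.gate f x := by
  by_contra! h
  have h1 : ¬ G.Avoids (hG.gate e v) v (hG.gate f v) := by
    refine hG.gate_not_avoids ?_
    rw [hG.gate_eq_gate hef (hG.gate_mem f v) hy]
    exact h.1
  have h2 : ¬ G.Avoids (hG.gate f v) v (hG.gate e v) := by
    refine hG.gate_not_avoids ?_
    rw [hG.gate_eq_gate hef.symm (hG.gate_mem e v) hx]
    exact h.2
  have h3 : hG.gate e v = hG.gate f v := by
    by_contra hne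
    have := hG.1.dist_lt_of_not_avoids hne h1
    have := hG.1.dist_lt_of_not_avoids (Ne.symm hne) h2
    omega
  apply h.1
  conv_lhs => rw [← hG.gate_of_mem (hG.gate_mem e v), h3]
  exact hG.gate_eq_gate hef (hG.gate_mem f v) hy

theorem exists_parentBlock (hG : G.IsHypertree) {i v : V} (h : i ≠ v) :
    ∃ e : G.StrongBlock, v ∈ e.1 ∧ hG.gate e i ≠ v := by
  obtain ⟨y, hyv, hlt⟩ := hG.1.exists_adj_dist_lt h
  obtain ⟨e, hy, hv⟩ := hyv.exists_strongBlock
  refine ⟨e, hv, fun hg => ?_⟩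
  have := hG.not_avoids_gate i hy
  rw [hg] at this
  exact this (hG.1.avoids_of_dist_le hyv.ne.symm hlt.le)

theorem parentBlock_unique (hG : G.IsHypertree) {i v : V} {e f : G.StrongBlock} (hve : v ∈ e.1)
    (he : hG.gate e i ≠ v) (hvf : v ∈ f.1) (hf : hG.gate f i ≠ v) : e = f := by
  by_contra hef
  have := hG.gate_eq_or_gate_eq hef hve hvf i
  rw [hG.gate_of_mem hve, hG.gate_of_mem hvf] at this
  tauto

open Classical in
/-- The block of `v` on the way to the root `r` (any block if `v = r`). -/
noncomputable def parentBlock (hG : G.IsHypertree) (r v : V) : G.StrongBlock :=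
  if h : r ≠ v then (hG.exists_parentBlock h).choose else (exists_strongBlock_mem v).choose

theorem mem_parentBlock (hG : G.IsHypertree) (r v : V) : v ∈ (hG.parentBlock r v).1 := by
  unfold parentBlock
  split_ifs with h
  · exact (hG.exists_parentBlock h).choose_spec.1
  · exact (exists_strongBlock_mem v).choose_spec

/-- The next gate on the way from `v` to the root `r`. -/
noncomputable def parent (hG : G.IsHypertree) (r v : V) : V := hG.gate (hG.parentBlock r v) r

theorem parent_mem (hG : G.IsHypertree) (r v : V) : hG.parent r v ∈ (hG.parentBlock r v).1 :=
  hG.gate_mem _ _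

theorem parent_ne (hG : G.IsHypertree) {r v : V} (h : r ≠ v) : hG.parent r v ≠ v := by
  unfold parent parentBlock
  rw [dif_pos h]
  exact (hG.exists_parentBlock h).choose_spec.2

theorem parentBlock_eq (hG : G.IsHypertree) {r v : V} {e : G.StrongBlock} (hv : v ∈ e.1)
    (h : hG.gate e r ≠ v) : hG.parentBlock r v = e := by
  have hr : r ≠ v := fun hr => h (by rw [hr, hG.gate_of_mem hv])
  exact hG.parentBlock_unique (hG.mem_parentBlock r v) (hG.parent_ne hr) hv h

theorem parent_not_avoids (hG : G.IsHypertree) (r v : V) : ¬ G.Avoids (hG.parent r v) r v :=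
  hG.not_avoids_gate r (hG.mem_parentBlock r v)

theorem dist_parent_lt (hG : G.IsHypertree) {r v : V} (h : r ≠ v) :
    G.dist r (hG.parent r v) < G.dist r v :=
  hG.1.dist_lt_of_not_avoids (hG.parent_ne h) (hG.parent_not_avoids r v)

end IsHypertree

theorem Separates.of_not_avoids {v i j : V} (hG : G.Connected) (hi : v ≠ i) (hj : v ≠ j)
    (h : ¬ G.Avoids v i j) : G.Separates v i j :=
  ⟨hi, hj, hG i j, fun p => by_contra fun hp => h ⟨p, hp⟩⟩

theorem Separates.not_avoids {v i j : V} (h : G.Separates v i j) : ¬ G.Avoids v i j :=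
  fun ⟨p, hp⟩ => hp (h.2.2.2 p)

/-- Two separating vertices come in one of two orders. -/
theorem not_avoids_order {v w i j : V} (hv : ¬ G.Avoids v i j) (hw : ¬ G.Avoids w i j)
    (hr : G.Reachable i j) :
    (¬ G.Avoids v i w ∧ ¬ G.Avoids w v j) ∨ (¬ G.Avoids w i v ∧ ¬ G.Avoids v w j) := by
  classical
  by_cases hvw : v = w
  · subst hvw
    exact Or.inl ⟨fun ⟨p, hp⟩ => hp p.end_mem_support, fun ⟨p, hp⟩ => hp p.start_mem_support⟩
  obtain ⟨p, hp⟩ := hr.exists_isPath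
  have hvp : v ∈ p.support := by_contra fun h => hv ⟨p, h⟩
  have hwp : w ∈ p.support := by_contra fun h => hw ⟨p, h⟩
  have key : ∀ {v w : V}, v ≠ w → ¬ G.Avoids v i j → ¬ G.Avoids w i j → ∀ hwp : w ∈ p.support,
      v ∈ (p.takeUntil w hwp).support → ¬ G.Avoids v i w ∧ ¬ G.Avoids w v j := by
    intro v w hvw hv hw hwp h
    refine ⟨fun hav => hv (hav.trans ⟨p.dropUntil w hwp, fun h' => ?_⟩), fun hav => hw
      (Avoids.trans ⟨(p.takeUntil w hwp).takeUntil v h, fun h' => ?_⟩ hav)⟩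
    · have hs := p.take_spec hwp
      rw [← hs] at hp
      exact hp.ne_of_mem_support_of_append hvw h h' rfl
    · have hs := (p.takeUntil w hwp).take_spec h
      have hp' := hp.takeUntil hwp
      rw [← hs] at hp'
      exact hp'.ne_of_mem_support_of_append hvw.symm h' (Walk.end_mem_support _) rfl
  by_cases h : v ∈ (p.takeUntil w hwp).support
  · exact Or.inl (key hvw hv hw hwp h)
  · right
    refine key (Ne.symm hvw) hw hv hvp ?_
    by_contra h'
    have hs := p.take_spec hwp
    have hvd : v ∈ (p.dropUntil w hwp).support := by
      rw [← hs, Walk.mem_support_append_iff] at hvp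
      tauto
    refine hw ⟨(p.takeUntil v hvp).append ((p.dropUntil w hwp).dropUntil v hvd), fun hmem => ?_⟩
    rw [Walk.mem_support_append_iff] at hmem
    rcases hmem with hmem | hmem
    · exact h' hmem
    · have hq := hp.dropUntil hwp
      have hs2 := (p.dropUntil w hwp).take_spec hvd
      rw [← hs2] at hq
      exact hq.ne_of_mem_support_of_append (Ne.symm hvw) (Walk.start_mem_support _) hmem rfl

end SimpleGraph

namespace SimpleGraph

variable {V : Type*} {G : SimpleGraph V}

namespace IsHypertree

theorem exists_separates [Finite V] (hG : G.IsHypertree) {i j : V}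
    (h : ¬ ∃ e : G.StrongBlock, i ∈ e.1 ∧ j ∈ e.1) : ∃ v, G.Separates v i j := by
  have hij : i ≠ j := by
    rintro rfl
    obtain ⟨e, he⟩ := exists_strongBlock_mem (G := G) i
    exact h ⟨e, he, he⟩
  refine ⟨hG.parent i j, Separates.of_not_avoids hG.1 ?_ (hG.parent_ne hij)
    (hG.parent_not_avoids i j)⟩
  intro hp
  have hi := hG.parent_mem i j
  rw [hp] at hi
  exact h ⟨hG.parentBlock i j, hi, hG.mem_parentBlock i j⟩

theorem not_separates_of_mem (hG : G.IsHypertree) {e : G.StrongBlock} {v i j : V}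
    (hi : i ∈ e.1) (hj : j ∈ e.1) : ¬ G.Separates v i j := by
  intro h
  apply h.not_avoids
  by_cases hij : i = j
  · subst hij
    exact ⟨Walk.nil, by simpa using h.1⟩
  · exact (hG.adj_of_mem hi hj hij).avoids h.1 h.2.1

end IsHypertree

namespace BlockDatum

variable {R : Type*} [CommRing R] [Finite V] (𝒢 : G.BlockDatum R)

theorem multDist_of_mem (hG : G.IsHypertree) {e : G.StrongBlock} {i j : V} (hi : i ∈ e.1)
    (hj : j ∈ e.1) : 𝒢.multDist i j = 𝒢.mat e ⟨i, hi⟩ ⟨j, hj⟩ := by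
  have h : ∃ e : G.StrongBlock, i ∈ e.1 ∧ j ∈ e.1 := ⟨e, hi, hj⟩
  rw [multDist, dif_pos h]
  by_cases hij : i = j
  · subst hij
    rw [𝒢.mat_diag, 𝒢.mat_diag]
  · have key : ∀ (f : G.StrongBlock) (hi' : i ∈ f.1) (hj' : j ∈ f.1),
        𝒢.mat f ⟨i, hi'⟩ ⟨j, hj'⟩ = 𝒢.mat e ⟨i, hi⟩ ⟨j, hj⟩ := by
      intro f hi' hj'
      obtain rfl := hG.strongBlock_eq hij hi hj hi' hj'
      rfl
    exact key _ _ _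

theorem addMultDist_of_mem (hG : G.IsHypertree) {e : G.StrongBlock} {i j : V} (hi : i ∈ e.1)
    (hj : j ∈ e.1) : 𝒢.addMultDist i j = 𝒢.a e * (𝒢.multDist i j - 1) := by
  have h : ∃ e : G.StrongBlock, i ∈ e.1 ∧ j ∈ e.1 := ⟨e, hi, hj⟩
  rw [addMultDist, dif_pos h, 𝒢.multDist_of_mem hG hi hj]
  by_cases hij : i = j
  · subst hij
    rw [𝒢.mat_diag, 𝒢.mat_diag, sub_self, mul_zero, mul_zero]
  · have key : ∀ (f : G.StrongBlock) (hi' : i ∈ f.1) (hj' : j ∈ f.1),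
        𝒢.a f * (𝒢.mat f ⟨i, hi'⟩ ⟨j, hj'⟩ - 1) = 𝒢.a e * (𝒢.mat e ⟨i, hi⟩ ⟨j, hj⟩ - 1) := by
      intro f hi' hj'
      obtain rfl := hG.strongBlock_eq hij hi hj hi' hj'
      rfl
    exact key _ _ _

theorem multDist_self (hG : G.IsHypertree) (i : V) : 𝒢.multDist i i = 1 := by
  obtain ⟨e, he⟩ := exists_strongBlock_mem (G := G) i
  rw [𝒢.multDist_of_mem hG he he, 𝒢.mat_diag]

theorem addMultDist_self (hG : G.IsHypertree) (i : V) : 𝒢.addMultDist i i = 0 := by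
  obtain ⟨e, he⟩ := exists_strongBlock_mem (G := G) i
  rw [𝒢.addMultDist_of_mem hG he he, 𝒢.multDist_self hG, sub_self, mul_zero]

theorem multDist_eq_mul (hG : G.IsHypertree) {v i j : V} (h : ¬ G.Avoids v i j) :
    𝒢.multDist i j = 𝒢.multDist i v * 𝒢.multDist v j := by
  induction hn : G.dist i j using Nat.strong_induction_on generalizing v i j with
  | _ n ih =>
  by_cases hvi : v = i
  · rw [hvi, 𝒢.multDist_self hG, one_mul]
  by_cases hvj : v = j
  · rw [hvj, 𝒢.multDist_self hG, mul_one]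
  have hs := Separates.of_not_avoids hG.1 hvi hvj h
  have hno : ¬ ∃ e : G.StrongBlock, i ∈ e.1 ∧ j ∈ e.1 := fun ⟨e, hi, hj⟩ =>
    hG.not_separates_of_mem hi hj hs
  have hex := hG.exists_separates hno
  rw [multDist, dif_neg hno, dif_pos hex]
  have hw := hex.choose_spec
  generalize hex.choose = w at hw
  rcases not_avoids_order h hw.not_avoids (hG.1 i j) with ⟨h1, h2⟩ | ⟨h1, h2⟩
  · rw [ih _ (hn ▸ hw.dist_left_lt) h1 rfl, ih _ (hn ▸ hs.dist_right_lt) h2 rfl, mul_assoc]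
  · rw [ih _ (hn ▸ hs.dist_left_lt) h1 rfl, ih _ (hn ▸ hw.dist_right_lt) h2 rfl, mul_assoc]

theorem addMultDist_eq_add (hG : G.IsHypertree) {v i j : V} (h : ¬ G.Avoids v i j) :
    𝒢.addMultDist i j = 𝒢.addMultDist i v + 𝒢.multDist i v * 𝒢.addMultDist v j := by
  induction hn : G.dist i j using Nat.strong_induction_on generalizing v i j with
  | _ n ih =>
  by_cases hvi : v = i
  · rw [hvi, 𝒢.multDist_self hG, 𝒢.addMultDist_self hG, one_mul, zero_add]
  by_cases hvj : v = j
  · rw [hvj, 𝒢.addMultDist_self hG, mul_zero, add_zero]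
  have hs := Separates.of_not_avoids hG.1 hvi hvj h
  have hno : ¬ ∃ e : G.StrongBlock, i ∈ e.1 ∧ j ∈ e.1 := fun ⟨e, hi, hj⟩ =>
    hG.not_separates_of_mem hi hj hs
  have hex := hG.exists_separates hno
  rw [addMultDist, dif_neg hno, dif_pos hex]
  have hw := hex.choose_spec
  generalize hex.choose = w at hw
  rcases not_avoids_order h hw.not_avoids (hG.1 i j) with ⟨h1, h2⟩ | ⟨h1, h2⟩
  · rw [ih _ (hn ▸ hw.dist_left_lt) h1 rfl, ih _ (hn ▸ hs.dist_right_lt) h2 rfl,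
      𝒢.multDist_eq_mul hG h1]
    ring
  · rw [ih _ (hn ▸ hs.dist_left_lt) h1 rfl, ih _ (hn ▸ hw.dist_right_lt) h2 rfl,
      𝒢.multDist_eq_mul hG h1]
    ring

theorem addMultDist_eq_sum [Fintype G.StrongBlock] (hG : G.IsHypertree) (i j : V) :
    𝒢.addMultDist i j = ∑ e : G.StrongBlock,
      𝒢.a e * (𝒢.multDist i (hG.gate e j) - 𝒢.multDist i (hG.gate e i)) := by
  classical
  induction hn : G.dist i j using Nat.strong_induction_on generalizing j with
  | _ n ih =>
  by_cases hij : i = j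
  · subst hij
    simp [𝒢.addMultDist_self hG]
  have hav := hG.parent_not_avoids i j
  have hp := hG.parent_mem i j
  have hj := hG.mem_parentBlock i j
  rw [𝒢.addMultDist_eq_add hG hav, ih _ (hn ▸ hG.dist_parent_lt hij) _ rfl,
    𝒢.addMultDist_of_mem hG hp hj]
  have : 𝒢.multDist i (hG.parent i j) *
      (𝒢.a (hG.parentBlock i j) * (𝒢.multDist (hG.parent i j) j - 1)) =
      ∑ e : G.StrongBlock, if e = hG.parentBlock i j then 𝒢.multDist i (hG.parent i j) *
      (𝒢.a (hG.parentBlock i j) * (𝒢.multDist (hG.parent i j) j - 1)) else 0 := by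
    simp
  rw [this, ← Finset.sum_add_distrib]
  refine Finset.sum_congr rfl fun e _ => ?_
  split_ifs with he
  · subst he
    rw [hG.gate_of_mem hp, hG.gate_of_mem hj, 𝒢.multDist_eq_mul hG hav]
    ring
  · rw [hG.gate_eq_gate he hp hj, add_zero]

end BlockDatum

end SimpleGraph

namespace Matrix

variable {n R : Type*} [Fintype n] [DecidableEq n] [CommRing R]

theorem det_eq_prod_diag {α : Type*} [LinearOrder α] (A : Matrix n n R) (r : n → α)
    (h : ∀ i j, i ≠ j → r j ≤ r i → A i j = 0) : A.det = ∏ i, A i i := by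
  have hA : A.BlockTriangular r := fun i j hij => h i j (fun e => by simp [e] at hij) hij.le
  rw [hA.det, ← Finset.prod_fiberwise_of_maps_to (g := r) (t := Finset.univ.image r)
    (fun i _ => Finset.mem_image_of_mem r (Finset.mem_univ i))]
  refine Finset.prod_congr rfl fun k _ => ?_
  have : A.toSquareBlock r k =
      diagonal fun i : {a // r a = k} => A i i := by
    ext i j
    by_cases hij : i = j
    · subst hij; simp [toSquareBlock_def]
    · rw [diagonal_apply_ne _ hij, toSquareBlock_def, of_apply]
      exact h _ _ (fun e => hij (Subtype.ext e)) (by rw [i.2, j.2])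
  rw [this, det_diagonal]
  exact (Finset.prod_subtype (Finset.univ.filter fun i => r i = k) (by simp)
    (fun i => A i i)).symm

theorem det_eq_prod_toSquareBlock {κ : Type*} [Fintype κ] [DecidableEq κ] (A : Matrix n n R)
    (b : n → κ) (h : ∀ i j, b i ≠ b j → A i j = 0) :
    A.det = ∏ k, (A.toSquareBlock b k).det := by
  let : LinearOrder κ := LinearOrder.lift' (Fintype.equivFin κ) (Fintype.equivFin κ).injective
  exact BlockTriangular.det_fintype fun i j hij => h i j hij.ne'

/-- The Schur complement of a diagonal entry `1`. -/
theorem det_eq_det_schur (A : Matrix n n R) (p : n) (hp : A p p = 1) :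
    A.det = det (of fun i j : {v : n // v ≠ p} => A i j - A i p * A p j) := by
  let B : Matrix n n R := of fun i j => if i = p then A p j else A i j - A i p * A p j
  have hAB : A.det = B.det := by
    refine (det_eq_of_forall_row_eq_smul_add_const (fun i => if i = p then 0 else - A i p) p
      (by simp) fun i j => ?_).symm
    by_cases hi : i = p
    · simp [B, hi]
    · simp [B, hi]; ring
  rw [hAB, twoBlockTriangular_det' B (fun i => i ≠ p)]
  · have h1 : (B.toSquareBlockProp fun i => ¬ i ≠ p) = 1 := by
      ext ⟨i, hi⟩ ⟨j, hj⟩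
      rw [not_not] at hi hj
      subst hi; subst hj
      simp [toSquareBlockProp, B, hp]
    rw [h1, det_one, mul_one]
    congr 1
    ext ⟨i, hi⟩ ⟨j, hj⟩
    simp [toSquareBlockProp, B, hi]
  · intro i hi j hj
    rw [not_not] at hj
    subst hj
    simp [B, hi, hp]

theorem sum_adjugate_col (A : Matrix n n R) (j : n) :
    ∑ i, A.adjugate i j = (A.updateRow j 1).det := by
  have : (1 : n → R) = ∑ i, Pi.single i 1 := by
    ext k; simp [Finset.sum_apply, Pi.single_apply]
  simp only [adjugate_apply]
  rw [this]
  have h : ∀ s : Finset n, ∑ i ∈ s, (A.updateRow j (Pi.single i 1)).det =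
      (A.updateRow j (∑ i ∈ s, Pi.single i 1)).det := by
    intro s
    induction s using Finset.induction_on with
    | empty => simp [det_eq_zero_of_row_eq_zero (A := A.updateRow j 0) j (by simp)]
    | insert a s ha ih => rw [Finset.sum_insert ha, Finset.sum_insert ha, det_updateRow_add, ih]
  exact h _

theorem det_add_ones (A : Matrix n n R) :
    (A + of fun _ _ => 1).det = A.det + A.cofactorSum := by
  have key : ∀ s : Finset n, (of fun i j => A i j + if i ∈ s then 1 else 0).det =
      A.det + ∑ j ∈ s, (A.updateRow j 1).det := by
    intro s
    induction s using Finset.induction_on with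
    | empty =>
      simp only [Finset.notMem_empty, if_false, add_zero, Finset.sum_empty]
      rfl
    | insert a s ha ih =>
      rw [Finset.sum_insert ha, add_left_comm, ← ih]
      let B : Matrix n n R := of fun i j => A i j + if i ∈ s then 1 else 0
      have h1 : (of fun i j => A i j + if i ∈ insert a s then 1 else 0) =
          B.updateRow a (1 + B a) := by
        ext i j
        by_cases hi : i = a
        · subst hi; simp [B, ha, add_comm]
        · simp [B, hi]
      rw [h1, det_updateRow_add, updateRow_eq_self]
      congr 1
      refine det_eq_of_forall_row_eq_smul_add_const (fun i => if i ∈ s then 1 else 0) a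
        (by simp [ha]) fun i j => ?_
      by_cases hi : i = a
      · subst hi; simp [ha]
      · simp [B, hi]
  have := key Finset.univ
  simp only [Finset.mem_univ, if_true] at this
  have hc : A.cofactorSum = ∑ j, (A.updateRow j 1).det :=
    Finset.sum_comm.trans (Finset.sum_congr rfl fun j _ => A.sum_adjugate_col j)
  rw [hc, ← this]
  rfl

end Matrix

namespace SimpleGraph

variable {V : Type*} {G : SimpleGraph V} [Fintype V]

@[to_additive]
theorem IsHypertree.prod_parentBlock {N : Type*} [CommMonoid N] [DecidableEq V] (hG : G.IsHypertree) (r : V)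
    (φ : G.StrongBlock → V → N) : ∏ v with v ≠ r, φ (hG.parentBlock r v) v =
      ∏ e : G.StrongBlock, ∏ v ∈ e.1.erase (hG.gate e r), φ e v := by
  rw [Finset.prod_sigma']
  refine Finset.prod_bij' (fun v _ => ⟨hG.parentBlock r v, v⟩) (fun x _ => x.2) ?_ ?_ ?_ ?_ ?_
  · intro v hv
    simp only [Finset.mem_filter, Finset.mem_univ, true_and] at hv
    simp only [Finset.mem_sigma, Finset.mem_univ, true_and, Finset.mem_erase]
    exact ⟨(hG.parent_ne (Ne.symm hv)).symm, hG.mem_parentBlock r v⟩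
  · rintro ⟨e, v⟩ hv
    simp only [Finset.mem_sigma, Finset.mem_univ, true_and, Finset.mem_erase] at hv
    simp only [Finset.mem_filter, Finset.mem_univ, true_and]
    rintro rfl
    exact hv.1 (hG.gate_of_mem hv.2).symm
  · intros; rfl
  · rintro ⟨e, v⟩ hv
    simp only [Finset.mem_sigma, Finset.mem_univ, true_and, Finset.mem_erase] at hv
    simp only [hG.parentBlock_eq hv.2 hv.1.symm]
  · intros; rfl

theorem IsHypertree.sum_eq {R : Type*} [CommRing R] (hG : G.IsHypertree) (r : V) (φ : V → R) :
    ∑ v, φ v = φ r + ∑ e : G.StrongBlock, (∑ v ∈ e.1, φ v - φ (hG.gate e r)) := by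
  classical
  have h := hG.sum_parentBlock r fun _ v => φ v
  have h1 : ∀ e : G.StrongBlock, ∑ v ∈ e.1.erase (hG.gate e r), φ v =
      ∑ v ∈ e.1, φ v - φ (hG.gate e r) := fun e => by
    rw [← Finset.add_sum_erase _ _ (hG.gate_mem e r)]; ring
  simp only [h1] at h
  rw [← h, ← Finset.add_sum_erase _ _ (Finset.mem_univ r)]
  congr 2
  ext; simp

theorem IsHypertree.prod_pow {R : Type*} [CommRing R] [DecidableEq V] (hG : G.IsHypertree) (r : V)
    (a : G.StrongBlock → R) : ∏ v with v ≠ r, a (hG.parentBlock r v) =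
      ∏ e : G.StrongBlock, a e ^ (e.1.card - 1) := by
  have h := hG.prod_parentBlock r fun e _ => a e
  simp only [Finset.prod_const] at h
  exact h.trans (Finset.prod_congr rfl fun e _ => by
    rw [Finset.card_erase_of_mem (hG.gate_mem e r)])

end SimpleGraph

namespace SimpleGraph

open Matrix

variable {V : Type*} {G : SimpleGraph V} [Fintype V] [DecidableEq V] {R : Type*} [CommRing R]

namespace IsHypertree

/-- The matrix whose column `j` is `∑ e, a e • δ (gate e j) + u`. -/
noncomputable def gateMatrix (hG : G.IsHypertree) (a : G.StrongBlock → R) (u : V → R) :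
    Matrix V V R :=
  of fun v j => ∑ e : G.StrongBlock, (if hG.gate e j = v then a e else 0) + u v

theorem det_gateMatrix (hG : G.IsHypertree) (r : V) (a : G.StrongBlock → R) (u : V → R) :
    (hG.gateMatrix a u).det =
      (∏ e : G.StrongBlock, a e ^ (e.1.card - 1)) * (∑ e : G.StrongBlock, a e + ∑ v, u v) := by
  classical
  let C : Matrix V V R := of fun k j =>
    (if k = j then 1 else 0) - if j ≠ r ∧ k = hG.parent r j then 1 else 0
  let S : Matrix V V R := of fun v k => if v = r then 1 else if v = k then 1 else 0
  have hC : C.det = 1 := by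
    rw [C.det_eq_prod_diag (fun v => G.dist r v)]
    · refine Finset.prod_eq_one fun j _ => ?_
      have : ¬ (j ≠ r ∧ j = hG.parent r j) := fun h => hG.parent_ne (Ne.symm h.1) h.2.symm
      simp only [C, of_apply, if_true, if_neg this, sub_zero]
    · intro i j hij hd
      have : ¬ (j ≠ r ∧ i = hG.parent r j) := by
        rintro ⟨h1, rfl⟩
        exact absurd (hG.dist_parent_lt (Ne.symm h1)) (not_lt.2 hd)
      simp only [C, of_apply, if_neg hij, if_neg this, sub_zero]
  have hS : S.det = 1 := by
    rw [S.det_eq_prod_diag (fun v => if v = r then 0 else 1)]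
    · exact Finset.prod_eq_one fun j _ => by simp [S]
    · intro i j hij hd
      by_cases hi : i = r
      · subst hi; simp [Ne.symm hij] at hd
      · simp [S, hi, hij]
  have hBC : ∀ v j, (hG.gateMatrix a u * C) v j = hG.gateMatrix a u v j -
      if j ≠ r then hG.gateMatrix a u v (hG.parent r j) else 0 := by
    intro v j
    simp only [mul_apply, C, of_apply, mul_sub, Finset.sum_sub_distrib, mul_ite, mul_one, mul_zero,
      Finset.sum_ite_eq', Finset.mem_univ, if_true]
    by_cases hj : j = r <;> simp [hj]
  have hBC' : ∀ v j, j ≠ r → (hG.gateMatrix a u * C) v j =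
      a (hG.parentBlock r j) * ((if j = v then 1 else 0) - if hG.parent r j = v then 1 else 0) := by
    intro v j hj
    rw [hBC, if_pos hj]
    simp only [gateMatrix, of_apply, add_sub_add_right_eq_sub, ← Finset.sum_sub_distrib]
    rw [Finset.sum_eq_single (hG.parentBlock r j)]
    · rw [hG.gate_of_mem (hG.mem_parentBlock r j), hG.gate_of_mem (hG.parent_mem r j)]
      simp only [mul_sub, mul_ite, mul_one, mul_zero]
    · intro e _ he
      rw [hG.gate_eq_gate he (hG.parent_mem r j) (hG.mem_parentBlock r j), sub_self]
    · simp
  let T : Matrix V V R := S * (hG.gateMatrix a u * C)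
  have hTr : ∀ j, T r j = ∑ v, (hG.gateMatrix a u * C) v j := by
    intro j
    simp [T, S, mul_apply (M := S)]
  have hTv : ∀ v j, v ≠ r → T v j = (hG.gateMatrix a u * C) v j := by
    intro v j hv
    simp [T, S, mul_apply (M := S), hv]
  have hTrj : ∀ j, j ≠ r → T r j = 0 := by
    intro j hj
    rw [hTr]
    simp only [hBC' _ _ hj, ← Finset.mul_sum, Finset.sum_sub_distrib]
    simp
  have hTrr : T r r = ∑ e : G.StrongBlock, a e + ∑ v, u v := by
    have h : ∀ v, (hG.gateMatrix a u * C) v r = hG.gateMatrix a u v r := by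
      intro v
      rw [hBC, if_neg (not_not.2 rfl), sub_zero]
    rw [hTr, Finset.sum_congr rfl fun v _ => h v]
    simp only [gateMatrix, of_apply, Finset.sum_add_distrib]
    rw [Finset.sum_comm]
    simp
  have hT : T.det = (hG.gateMatrix a u).det := by
    simp [T, det_mul, hS, hC]
  rw [← hT, T.det_eq_prod_diag (fun v => if v = r then (⊤ : WithTop ℕ) else (G.dist r v : ℕ))]
  · rw [← Finset.mul_prod_erase _ _ (Finset.mem_univ r), hTrr, mul_comm, ← hG.prod_pow r]
    congr 1
    refine Finset.prod_congr (by ext; simp) fun v hv => ?_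
    have hv : v ≠ r := by simpa using hv
    rw [hTv _ _ hv, hBC' _ _ hv]
    simp [hG.parent_ne (Ne.symm hv)]
  · intro i j hij hd
    by_cases hi : i = r
    · subst hi; exact hTrj _ (Ne.symm hij)
    · rw [if_neg hi] at hd
      by_cases hj : j = r
      · simp [hj] at hd
      · rw [if_neg hj] at hd
        rw [hTv _ _ hi, hBC' _ _ hj, if_neg (Ne.symm hij), if_neg]
        · simp
        · rintro rfl
          have := hG.dist_parent_lt (Ne.symm hj)
          have hd' : G.dist r j ≤ G.dist r (hG.parent r j) := by exact_mod_cast hd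
          omega

end IsHypertree

namespace BlockDatum

variable (𝒢 : G.BlockDatum R)

/-- The multiplicative distance matrix. -/
noncomputable def multMatrix : Matrix V V R :=
  of fun i j => 𝒢.multDist i j

theorem det_mat (hG : G.IsHypertree) (r : V) (e : G.StrongBlock)
    {ι : Type*} [Fintype ι] [DecidableEq ι] (f : ι ≃ {w : e.1 // w.1 ≠ hG.gate e r}) :
    (𝒢.mat e).det = (of fun k j : ι => 𝒢.multDist (f k).1.1 (f j).1.1 -
      𝒢.multDist (f k).1.1 (hG.gate e r) * 𝒢.multDist (hG.gate e r) (f j).1.1).det := by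
  let p : e.1 := ⟨hG.gate e r, hG.gate_mem e r⟩
  let f' : ι ≃ {w : e.1 // w ≠ p} :=
    f.trans (Equiv.subtypeEquivRight fun w => by rw [ne_eq, ne_eq, Subtype.ext_iff])
  rw [(𝒢.mat e).det_eq_det_schur p (𝒢.mat_diag e p), ← det_reindex_self f'.symm]
  congr 1
  ext k j
  simp only [reindex_apply, submatrix_apply, of_apply, Equiv.symm_symm]
  rw [𝒢.multDist_of_mem hG (f k).1.2 (f j).1.2, 𝒢.multDist_of_mem hG (f k).1.2 (hG.gate_mem e r),
    𝒢.multDist_of_mem hG (hG.gate_mem e r) (f j).1.2]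
  rfl

theorem det_multMatrix (hG : G.IsHypertree) (r : V) :
    𝒢.multMatrix.det = ∏ e : G.StrongBlock, (𝒢.mat e).det := by
  classical
  let C : Matrix V V R := of fun k j =>
    (if k = j then 1 else 0) - if j ≠ r ∧ k = hG.parent r j then 𝒢.multDist k j else 0
  let W : Matrix V V R := of fun i k =>
    if k = r ∨ hG.gate (hG.parentBlock r k) i = k then 𝒢.multDist i k else 0
  let Δ : Matrix V V R := of fun k j =>
    if j = r then (if k = r then 1 else 0) else if k ≠ r ∧ hG.parentBlock r k = hG.parentBlock r j
      then 𝒢.multDist k j - 𝒢.multDist k (hG.parent r j) * 𝒢.multDist (hG.parent r j) j else 0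
  have hC : C.det = 1 := by
    rw [C.det_eq_prod_diag (fun v => G.dist r v)]
    · refine Finset.prod_eq_one fun j _ => ?_
      have : ¬ (j ≠ r ∧ j = hG.parent r j) := fun h => hG.parent_ne (Ne.symm h.1) h.2.symm
      simp only [C, of_apply, if_true, if_neg this, sub_zero]
    · intro i j hij hd
      have : ¬ (j ≠ r ∧ i = hG.parent r j) := by
        rintro ⟨h1, rfl⟩
        exact absurd (hG.dist_parent_lt (Ne.symm h1)) (not_lt.2 hd)
      simp only [C, of_apply, if_neg hij, if_neg this, sub_zero]
  have hW : W.det = 1 := by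
    rw [W.det_eq_prod_diag (fun v => OrderDual.toDual (G.dist r v))]
    · refine Finset.prod_eq_one fun j _ => ?_
      simp only [W, of_apply]
      rw [if_pos (Or.inr (hG.gate_of_mem (hG.mem_parentBlock r j))), 𝒢.multDist_self hG]
    · intro i k hik hd
      rw [OrderDual.toDual_le_toDual] at hd
      simp only [W, of_apply]
      refine if_neg ?_
      by_cases hk : k = r
      · subst hk
        rw [G.dist_self, Nat.le_zero, hG.1.dist_eq_zero_iff] at hd
        exact absurd hd.symm hik
      · rintro (h | h)
        · exact hk h
        · have hne : hG.gate (hG.parentBlock r k) i ≠ hG.gate (hG.parentBlock r k) r := by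
            rw [h]; exact (hG.parent_ne (Ne.symm hk)).symm
          have hav := hG.gate_not_avoids hne
          rw [h] at hav
          have := hG.1.dist_lt_of_not_avoids (Ne.symm hik) fun h' => hav h'.symm
          omega
  have hMC : 𝒢.multMatrix * C = W * Δ := by
    ext i j
    have hl : (𝒢.multMatrix * C) i j = 𝒢.multDist i j - if j ≠ r then
        𝒢.multDist i (hG.parent r j) * 𝒢.multDist (hG.parent r j) j else 0 := by
      simp only [mul_apply, C, multMatrix, of_apply, mul_sub, Finset.sum_sub_distrib, mul_ite,
        mul_one, mul_zero, Finset.sum_ite_eq', Finset.mem_univ, if_true]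
      by_cases hj : j = r <;> simp [hj]
    rw [hl, mul_apply]
    by_cases hj : j = r
    · subst hj
      simp [W, Δ]
    rw [if_pos hj]
    have hterm : ∀ k, W i k * Δ k j = if k = hG.gate (hG.parentBlock r j) i then
        (if k = hG.parent r j then 0 else 𝒢.multDist i k *
          (𝒢.multDist k j - 𝒢.multDist k (hG.parent r j) * 𝒢.multDist (hG.parent r j) j)) else 0 := by
      intro k
      simp only [W, Δ, of_apply, if_neg hj]
      by_cases hk : k ≠ r ∧ hG.parentBlock r k = hG.parentBlock r j
      · rw [if_pos hk]
        have hkp : k ≠ hG.parent r j := by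
          have := hG.parent_ne (Ne.symm hk.1)
          rw [IsHypertree.parent, hk.2] at this
          exact Ne.symm this
        rw [hk.2, if_neg hkp]
        by_cases hg : hG.gate (hG.parentBlock r j) i = k
        · rw [if_pos (Or.inr hg), if_pos hg.symm]
        · rw [if_neg (by tauto), if_neg (Ne.symm hg), zero_mul]
      · rw [if_neg hk, mul_zero]
        split_ifs with h1 h2
        · rfl
        · exfalso
          have hke : k ∈ (hG.parentBlock r j).1 := h1 ▸ hG.gate_mem _ i
          refine hk ⟨?_, hG.parentBlock_eq hke (Ne.symm h2)⟩
          rintro rfl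
          exact h2 (hG.gate_of_mem hke).symm
        · rfl
    simp only [hterm, Finset.sum_ite_eq', Finset.mem_univ, if_true]
    have hp := hG.parent_mem r j
    have hj' := hG.mem_parentBlock r j
    have h1 := hG.not_avoids_gate i hj'
    have h2 := hG.not_avoids_gate i hp
    rw [𝒢.multDist_eq_mul hG h1, 𝒢.multDist_eq_mul hG h2]
    split_ifs with h
    · rw [h, 𝒢.multDist_self hG]; ring
    · ring
  have hdet : 𝒢.multMatrix.det = Δ.det := by
    have := congrArg det hMC
    rwa [det_mul, det_mul, hC, hW, one_mul, mul_one] at this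
  rw [hdet, Δ.det_eq_prod_toSquareBlock
    (fun k => if k = r then none else some (hG.parentBlock r k)), Fintype.prod_option]
  · have h0 : (Δ.toSquareBlock (fun k => if k = r then none else some (hG.parentBlock r k))
        none) = 1 := by
      ext ⟨i, hi⟩ ⟨j, hj⟩
      have hi : i = r := by simpa using hi
      have hj : j = r := by simpa using hj
      subst hi; subst hj
      simp [toSquareBlock_def, Δ]
    rw [h0, det_one, one_mul]
    refine Finset.prod_congr rfl fun e _ => ?_
    have hiff : ∀ k, (if k = r then none else some (hG.parentBlock r k)) = some e ↔
        ∃ _ : k ∈ e.1, k ≠ hG.gate e r := by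
      intro k
      by_cases hk : k = r
      · subst hk
        simp only [if_true, reduceCtorEq, false_iff, not_exists, not_not]
        exact fun hk => (hG.gate_of_mem hk).symm
      · simp only [if_neg hk, Option.some.injEq]
        constructor
        · rintro rfl
          exact ⟨hG.mem_parentBlock r k, (hG.parent_ne (Ne.symm hk)).symm⟩
        · rintro ⟨h1, h2⟩
          exact hG.parentBlock_eq h1 h2.symm
    let f : {k // (if k = r then none else some (hG.parentBlock r k)) = some e} ≃
        {w : e.1 // w.1 ≠ hG.gate e r} :=
      { toFun := fun k => ⟨⟨k.1, ((hiff k.1).1 k.2).1⟩, ((hiff k.1).1 k.2).2⟩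
        invFun := fun w => ⟨w.1.1, (hiff w.1.1).2 ⟨w.1.2, w.2⟩⟩
        left_inv := fun _ => rfl
        right_inv := fun _ => rfl }
    rw [𝒢.det_mat hG r e f]
    congr 1
    ext ⟨i, hi⟩ ⟨j, hj⟩
    by_cases hir : i = r
    · simp [hir] at hi
    by_cases hjr : j = r
    · simp [hjr] at hj
    have hie : hG.parentBlock r i = e := by simpa [hir] using hi
    have hje : hG.parentBlock r j = e := by simpa [hjr] using hj
    have hpj : hG.parent r j = hG.gate e r := by rw [← hje]; rfl
    simp only [toSquareBlock_def, Δ, of_apply, if_neg hjr]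
    rw [if_pos ⟨hir, hie.trans hje.symm⟩, hpj]
    rfl
  · intro k j hkj
    simp only [Δ, of_apply]
    by_cases hj : j = r
    · by_cases hk : k = r
      · simp [hj, hk] at hkj
      · simp [hj, hk]
    · rw [if_neg hj]
      refine if_neg fun h => hkj ?_
      simp [hj, h.1, h.2]

end BlockDatum

end SimpleGraph

namespace SimpleGraph

open Matrix

variable {V : Type*} {G : SimpleGraph V} [Fintype V] [DecidableEq V] {R : Type*} [CommRing R]

/-- Extension by zero of a family of vectors on the blocks. -/
def StrongBlock.extend (z : ∀ e : G.StrongBlock, e.1 → R) (e : G.StrongBlock) (v : V) : R :=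
  if h : v ∈ e.1 then z e ⟨v, h⟩ else 0

theorem StrongBlock.sum_mul_extend (z : ∀ e : G.StrongBlock, e.1 → R) (e : G.StrongBlock)
    (φ : V → R) : ∑ v, φ v * StrongBlock.extend z e v = ∑ v : e.1, φ v * z e v := by
  rw [← Finset.sum_subset (Finset.subset_univ e.1)
    (fun v _ hv => by rw [StrongBlock.extend, dif_neg hv, mul_zero]), ← Finset.sum_coe_sort]
  refine Finset.sum_congr rfl fun v _ => ?_
  rw [StrongBlock.extend, dif_pos v.2]

namespace BlockDatum

variable (𝒢 : G.BlockDatum R)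

theorem sum_multDist_mul_extend (hG : G.IsHypertree) {z : ∀ e : G.StrongBlock, e.1 → R}
    (hz : ∀ e, 𝒢.mat e *ᵥ z e = 1) (e : G.StrongBlock) (i : V) :
    ∑ v, 𝒢.multDist i v * StrongBlock.extend z e v = 𝒢.multDist i (hG.gate e i) := by
  have h := congrFun (hz e) ⟨hG.gate e i, hG.gate_mem e i⟩
  simp only [mulVec, dotProduct, Pi.one_apply] at h
  rw [StrongBlock.sum_mul_extend, ← mul_one (𝒢.multDist i (hG.gate e i)), ← h, Finset.mul_sum]
  refine Finset.sum_congr rfl fun v _ => ?_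
  rw [𝒢.multDist_eq_mul hG (hG.not_avoids_gate i v.2), 𝒢.multDist_of_mem hG (hG.gate_mem e i) v.2,
    mul_assoc]

/-- The determinant of the rank one perturbations of the distance matrix, when the all-ones vector
on each block is in the image of the matrix of the block. -/
theorem det_distMatrix_add (hG : G.IsHypertree) {z : ∀ e : G.StrongBlock, e.1 → R}
    (hz : ∀ e, 𝒢.mat e *ᵥ z e = 1) (u : V → R) :
    (𝒢.distMatrix + of fun i _ => ∑ v, 𝒢.multDist i v * u v).det =
      (∏ e : G.StrongBlock, 𝒢.a e ^ (e.1.card - 1) * (𝒢.mat e).det) *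
        (∑ e : G.StrongBlock, 𝒢.a e * (1 - ∑ v, z e v) + ∑ v, u v) := by
  obtain ⟨r⟩ := hG.1.nonempty
  let w : V → R := fun v => u v - ∑ e : G.StrongBlock, 𝒢.a e * StrongBlock.extend z e v
  have hfac : 𝒢.distMatrix + (of fun i _ => ∑ v, 𝒢.multDist i v * u v) =
      𝒢.multMatrix * hG.gateMatrix 𝒢.a w := by
    ext i j
    have h1 : ∑ v, 𝒢.multDist i v * ∑ e : G.StrongBlock, (if hG.gate e j = v then 𝒢.a e else 0) =
        ∑ e : G.StrongBlock, 𝒢.a e * 𝒢.multDist i (hG.gate e j) := by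
      simp only [Finset.mul_sum]
      rw [Finset.sum_comm]
      refine Finset.sum_congr rfl fun e _ => ?_
      simp [mul_comm]
    have h2 : ∑ v, 𝒢.multDist i v * ∑ e : G.StrongBlock, 𝒢.a e * StrongBlock.extend z e v =
        ∑ e : G.StrongBlock, 𝒢.a e * 𝒢.multDist i (hG.gate e i) := by
      simp only [Finset.mul_sum]
      rw [Finset.sum_comm]
      refine Finset.sum_congr rfl fun e _ => ?_
      rw [← 𝒢.sum_multDist_mul_extend hG hz e i, Finset.mul_sum]
      exact Finset.sum_congr rfl fun v _ => by ring
    simp only [Matrix.add_apply, distMatrix, of_apply, mul_apply, multMatrix, IsHypertree.gateMatrix, w,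
      mul_add, mul_sub, Finset.sum_add_distrib, Finset.sum_sub_distrib]
    rw [h1, h2, 𝒢.addMultDist_eq_sum hG]
    simp only [mul_sub, Finset.sum_sub_distrib]
    ring
  have hw : ∑ v, w v = ∑ v, u v - ∑ e : G.StrongBlock, 𝒢.a e * ∑ v, z e v := by
    simp only [w, Finset.sum_sub_distrib]
    rw [Finset.sum_comm]
    congr 1
    refine Finset.sum_congr rfl fun e _ => ?_
    rw [StrongBlock.sum_mul_extend, Finset.mul_sum]
  rw [hfac, det_mul, 𝒢.det_multMatrix hG r, hG.det_gateMatrix r, hw, Finset.prod_mul_distrib]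
  simp only [mul_sub, mul_one, Finset.sum_sub_distrib]
  ring

theorem det_distMatrix (hG : G.IsHypertree) {z : ∀ e : G.StrongBlock, e.1 → R}
    (hz : ∀ e, 𝒢.mat e *ᵥ z e = 1) :
    𝒢.distMatrix.det = (∏ e : G.StrongBlock, 𝒢.a e ^ (e.1.card - 1) * (𝒢.mat e).det) *
        ∑ e : G.StrongBlock, 𝒢.a e * (1 - ∑ v, z e v) := by
  have h := 𝒢.det_distMatrix_add hG hz 0
  simp only [Pi.zero_apply, mul_zero, Finset.sum_const_zero, add_zero] at h
  rw [← h]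
  congr 1
  ext i j
  simp

theorem cofactorSum_distMatrix (hG : G.IsHypertree) {z : ∀ e : G.StrongBlock, e.1 → R}
    (hz : ∀ e, 𝒢.mat e *ᵥ z e = 1) :
    𝒢.distMatrix.cofactorSum =
      (∏ e : G.StrongBlock, 𝒢.a e ^ (e.1.card - 1) * (𝒢.mat e).det) *
        (1 + ∑ e : G.StrongBlock, (∑ v, z e v - 1)) := by
  obtain ⟨r⟩ := hG.1.nonempty
  let b : V → R := fun v => 1 + ∑ e : G.StrongBlock,
    (StrongBlock.extend z e v - if v ∈ e.1 then 1 else 0)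
  have hb : ∀ i, ∑ v, 𝒢.multDist i v * b v = 1 := by
    intro i
    have h1 : ∑ v, 𝒢.multDist i v * b v = ∑ v, 𝒢.multDist i v -
        ∑ e : G.StrongBlock, (∑ v ∈ e.1, 𝒢.multDist i v - 𝒢.multDist i (hG.gate e i)) := by
      simp only [b, mul_add, mul_one, Finset.sum_add_distrib, Finset.mul_sum]
      rw [Finset.sum_comm, sub_eq_add_neg, ← Finset.sum_neg_distrib]
      congr 1
      refine Finset.sum_congr rfl fun e _ => ?_
      simp only [mul_sub, Finset.sum_sub_distrib]
      rw [𝒢.sum_multDist_mul_extend hG hz]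
      simp
    rw [h1, hG.sum_eq i, 𝒢.multDist_self hG]
    ring
  have hbs : ∑ v, b v = 1 + ∑ e : G.StrongBlock, (∑ v, z e v - 1) := by
    have h1 : ∑ v, b v = ∑ _v : V, (1 : R) +
        ∑ e : G.StrongBlock, (∑ v, z e v - ∑ v ∈ e.1, 1) := by
      simp only [b, Finset.sum_add_distrib]
      rw [Finset.sum_comm]
      congr 1
      refine Finset.sum_congr rfl fun e _ => ?_
      rw [Finset.sum_sub_distrib]
      have := StrongBlock.sum_mul_extend z e fun _ => 1
      simp only [one_mul] at this
      rw [this]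
      simp
    rw [h1, hG.sum_eq r]
    simp only [Finset.sum_sub_distrib]
    ring
  have h := 𝒢.det_distMatrix_add hG hz b
  simp only [hb, hbs] at h
  rw [det_add_ones, 𝒢.det_distMatrix hG hz] at h
  rw [mul_add] at h
  exact add_left_cancel h

theorem kappa_eq_sub (hG : G.IsHypertree) (r : V) :
    𝒢.kappa r = (𝒢.distMatrix + of fun i _ => 𝒢.multDist i r).det - 𝒢.distMatrix.det := by
  let N : (V → R) → Matrix V V R := fun w =>
    updateRow (of fun i j => 𝒢.addMultDist i j - 𝒢.multDist i r * 𝒢.addMultDist r j) r w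
  have h1 : (𝒢.distMatrix + of fun i _ => 𝒢.multDist i r).det =
      (N (1 + 𝒢.addMultDist r)).det := by
    refine det_eq_of_forall_row_eq_smul_add_const
      (fun i => if i = r then 0 else 𝒢.multDist i r) r (by simp) fun i j => ?_
    by_cases hi : i = r
    · subst hi
      simp [N, distMatrix, 𝒢.multDist_self hG, add_comm]
    · simp [N, distMatrix, hi]; ring
  have h2 : 𝒢.distMatrix.det = (N (𝒢.addMultDist r)).det := by
    refine det_eq_of_forall_row_eq_smul_add_const
      (fun i => if i = r then 0 else 𝒢.multDist i r) r (by simp) fun i j => ?_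
    by_cases hi : i = r
    · subst hi
      simp [N, distMatrix]
    · simp [N, distMatrix, hi]
  have h3 : (N 1).det = 𝒢.kappa r := by
    rw [det_eq_det_schur (N 1) r (by simp [N]), kappa]
    congr 1
    ext ⟨i, hi⟩ ⟨j, hj⟩
    simp only [N, of_apply, updateRow_ne hi, updateRow_self, 𝒢.addMultDist_self hG, Pi.one_apply]
    ring
  rw [h1, h2, ← h3]
  simp only [N, det_updateRow_add, add_sub_cancel_right]

theorem kappa_eq (hG : G.IsHypertree) {z : ∀ e : G.StrongBlock, e.1 → R}
    (hz : ∀ e, 𝒢.mat e *ᵥ z e = 1) (r : V) :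
    𝒢.kappa r = ∏ e : G.StrongBlock, 𝒢.a e ^ (e.1.card - 1) * (𝒢.mat e).det := by
  have h := 𝒢.det_distMatrix_add hG hz (Pi.single r 1)
  simp only [Pi.single_apply, mul_ite, mul_one, mul_zero, Finset.sum_ite_eq', Finset.mem_univ,
    if_true] at h
  rw [kappa_eq_sub _ hG, h, 𝒢.det_distMatrix hG hz]
  ring

end BlockDatum

end SimpleGraph

namespace CliqueData

open Matrix

variable {ι R : Type*} [Fintype ι] [LinearOrder ι] [CommRing R] {m m' : ι → R}

theorem prod_ne_eq (hδ : ∀ v, IsUnit (1 - m v * m' v)) (v : ι) :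
    ∏ w with w ≠ v, (1 - m w * m' w) =
      Ring.inverse (1 - m v * m' v) * ∏ w, (1 - m w * m' w) := by
  rw [← Finset.mul_prod_erase _ _ (Finset.mem_univ v), ← mul_assoc,
    Ring.inverse_mul_cancel _ (hδ v), one_mul]
  exact Finset.prod_congr (by ext; simp) fun _ _ => rfl

theorem prod_ne_ne_eq (hδ : ∀ v, IsUnit (1 - m v * m' v)) {v w : ι} (hvw : v ≠ w) :
    ∏ u with u ≠ v ∧ u ≠ w, (1 - m u * m' u) =
      Ring.inverse ((1 - m v * m' v) * (1 - m w * m' w)) * ∏ u, (1 - m u * m' u) := by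
  have h : ∏ u, (1 - m u * m' u) = ((1 - m v * m' v) * (1 - m w * m' w)) *
      ∏ u with u ≠ v ∧ u ≠ w, (1 - m u * m' u) := by
    rw [← Finset.mul_prod_erase _ _ (Finset.mem_univ v),
      ← Finset.mul_prod_erase (Finset.univ.erase v) _ (a := w) (by simp [hvw.symm]), mul_assoc]
    congr 2
    refine Finset.prod_congr ?_ fun _ _ => rfl
    ext; simp [and_comm]
  rw [h, ← mul_assoc, Ring.inverse_mul_cancel _ ((hδ v).mul (hδ w)), one_mul]

theorem onePlusCleared_eq (hδ : ∀ v, IsUnit (1 - m v * m' v)) :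
    onePlusCleared m m' = onePlus m m' * ∏ v, (1 - m v * m' v) := by
  simp only [onePlusCleared, onePlus, dVec, add_mul, one_mul, Finset.sum_mul, prod_ne_eq hδ,
    mul_assoc]

theorem pairSumCleared_eq (hδ : ∀ v, IsUnit (1 - m v * m' v)) :
    pairSumCleared m m' = pairSum m m' * ∏ v, (1 - m v * m' v) := by
  simp only [pairSumCleared, pairSum, add_mul, Finset.sum_mul]
  congr 1
  refine Finset.sum_congr rfl fun x hx => ?_
  rw [prod_ne_ne_eq hδ (Finset.mem_filter.1 hx).2.ne]
  ring

theorem sum_pairs_eq (r : ι → R) :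
    ∑ x : ι × ι with x.1 < x.2, (m x.1 - m x.2) * (m' x.1 - m' x.2) * (r x.1 * r x.2) =
      (∑ v, m v * m' v * r v) * ∑ v, r v - (∑ v, m v * r v) * ∑ v, m' v * r v := by
  let φ : ι × ι → R := fun x => (m x.1 * m' x.1 - m x.1 * m' x.2) * (r x.1 * r x.2)
  have h1 : (∑ v, m v * m' v * r v) * ∑ v, r v - (∑ v, m v * r v) * ∑ v, m' v * r v =
      ∑ x, φ x := by
    rw [Finset.sum_mul_sum, Finset.sum_mul_sum, ← Finset.sum_sub_distrib, Fintype.sum_prod_type]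
    refine Finset.sum_congr rfl fun v _ => ?_
    rw [← Finset.sum_sub_distrib]
    exact Finset.sum_congr rfl fun w _ => by simp only [φ]; ring
  have h2 : ∑ x : ι × ι with ¬ x.1 < x.2, φ x = ∑ x : ι × ι with x.1 < x.2, φ x.swap := by
    have h3 : ∑ x : ι × ι with x.2 < x.1, φ x = ∑ x : ι × ι with x.1 < x.2, φ x.swap := by
      refine Finset.sum_bij' (fun x _ => x.swap) (fun x _ => x.swap) ?_ ?_ ?_ ?_ ?_ <;> simp
    rw [← h3]
    symm
    refine Finset.sum_subset (fun x => by simpa using le_of_lt) fun x hx hx' => ?_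
    have : x.1 = x.2 := le_antisymm (by simpa using hx') (by simpa using hx)
    simp [φ, this]
  rw [h1, ← Finset.sum_filter_add_sum_filter_not Finset.univ (fun x : ι × ι => x.1 < x.2) φ, h2,
    ← Finset.sum_add_distrib]
  exact Finset.sum_congr rfl fun x _ => by simp only [φ, Prod.fst_swap, Prod.snd_swap]; ring

theorem inverse_one_sub {x : R} (h : IsUnit (1 - x)) :
    Ring.inverse (1 - x) = 1 + x * Ring.inverse (1 - x) := by
  linear_combination Ring.mul_inverse_cancel _ h

theorem pairSum_eq (hδ : ∀ v, IsUnit (1 - m v * m' v)) :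
    pairSum m m' = onePlus m m' * (∑ v, Ring.inverse (1 - m v * m' v) - 1) -
      (∑ v, m v * Ring.inverse (1 - m v * m' v)) *
        ∑ v, m' v * Ring.inverse (1 - m v * m' v) := by
  have h1 : pairSum m m' = (Fintype.card ι : R) - 1 +
      ∑ x : ι × ι with x.1 < x.2, (m x.1 - m x.2) * (m' x.1 - m' x.2) *
        (Ring.inverse (1 - m x.1 * m' x.1) * Ring.inverse (1 - m x.2 * m' x.2)) := by
    rw [pairSum]
    congr 1
    refine Finset.sum_congr rfl fun x _ => ?_
    rw [Ring.mul_inverse_rev, mul_comm (Ring.inverse _)]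
  have h2 : ∑ v, Ring.inverse (1 - m v * m' v) = (Fintype.card ι : R) + ∑ v, dVec m m' v := by
    rw [Finset.sum_congr rfl fun v _ => inverse_one_sub (hδ v), Finset.sum_add_distrib]
    simp [dVec]
  rw [h1, sum_pairs_eq fun v => Ring.inverse (1 - m v * m' v)]
  have h3 : ∑ v, m v * m' v * Ring.inverse (1 - m v * m' v) = ∑ v, dVec m m' v := rfl
  rw [h3, onePlus, h2]
  ring

/-- The solution `z` of `M z = (1, …, 1)` for the matrix `M` of a clique. -/
noncomputable def solution (m m' : ι → R) (v : ι) : R :=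
  (1 - m v * (∑ w, m' w * Ring.inverse (1 - m w * m' w)) * Ring.inverse (onePlus m m')) *
    Ring.inverse (1 - m v * m' v)

theorem mulVec_solution (hδ : ∀ v, IsUnit (1 - m v * m' v)) (h1 : IsUnit (onePlus m m'))
    (M : Matrix ι ι R) (hM : ∀ i j, M i j = if i = j then 1 else m i * m' j) :
    M *ᵥ solution m m' = 1 := by
  have hM' : ∀ i j, M i j = (if i = j then 1 - m i * m' i else 0) + m i * m' j := by
    intro i j
    rw [hM]
    split_ifs with h
    · rw [h]; ring
    · ring
  have hs : ∑ v, m' v * solution m m' v = (∑ w, m' w * Ring.inverse (1 - m w * m' w)) *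
      Ring.inverse (onePlus m m') := by
    have hA : ∑ v, m v * m' v * Ring.inverse (1 - m v * m' v) = onePlus m m' - 1 := by
      simp [onePlus, dVec]
    have : ∑ v, m' v * solution m m' v = (∑ w, m' w * Ring.inverse (1 - m w * m' w)) -
        (∑ w, m' w * Ring.inverse (1 - m w * m' w)) * Ring.inverse (onePlus m m') *
        ∑ v, m v * m' v * Ring.inverse (1 - m v * m' v) := by
      rw [Finset.mul_sum, ← Finset.sum_sub_distrib]
      exact Finset.sum_congr rfl fun v _ => by simp only [solution]; ring
    rw [this, hA]
    linear_combination
      (-∑ w, m' w * Ring.inverse (1 - m w * m' w)) * Ring.inverse_mul_cancel _ h1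
  ext i
  simp only [mulVec, dotProduct, hM', add_mul, ite_mul, zero_mul, Finset.sum_add_distrib,
    Finset.sum_ite_eq, Finset.mem_univ, if_true, mul_assoc, ← Finset.mul_sum, Pi.one_apply]
  rw [hs, solution]
  linear_combination (1 - m i * (∑ w, m' w * Ring.inverse (1 - m w * m' w)) *
    Ring.inverse (onePlus m m')) * Ring.mul_inverse_cancel _ (hδ i)

theorem onePlus_mul_sum_solution (hδ : ∀ v, IsUnit (1 - m v * m' v))
    (h1 : IsUnit (onePlus m m')) :
    onePlus m m' * (∑ v, solution m m' v - 1) = pairSum m m' := by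
  have : ∑ v, solution m m' v = ∑ v, Ring.inverse (1 - m v * m' v) -
      (∑ w, m' w * Ring.inverse (1 - m w * m' w)) * Ring.inverse (onePlus m m') *
      ∑ v, m v * Ring.inverse (1 - m v * m' v) := by
    rw [Finset.mul_sum, ← Finset.sum_sub_distrib]
    exact Finset.sum_congr rfl fun v _ => by simp only [solution]; ring
  rw [this, pairSum_eq hδ]
  linear_combination (-(∑ w, m' w * Ring.inverse (1 - m w * m' w)) *
    ∑ v, m v * Ring.inverse (1 - m v * m' v)) * Ring.mul_inverse_cancel _ h1

theorem det_eq_onePlusCleared (hδ : ∀ v, IsUnit (1 - m v * m' v))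
    (M : Matrix ι ι R) (hM : ∀ i j, M i j = if i = j then 1 else m i * m' j) :
    M.det = onePlusCleared m m' := by
  have h : M = diagonal (fun v => 1 - m v * m' v) *
      (1 + replicateCol Unit (fun v => Ring.inverse (1 - m v * m' v) * m v) *
        replicateRow Unit m') := by
    ext i j
    have hi := Ring.mul_inverse_cancel _ (hδ i)
    rw [diagonal_mul, hM, Matrix.add_apply]
    simp only [mul_apply, replicateCol_apply, replicateRow_apply, Finset.univ_unique,
      Finset.sum_singleton]
    by_cases hij : i = j
    · subst hij
      rw [if_pos rfl, one_apply_eq]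
      linear_combination (-m i * m' i) * hi
    · rw [if_neg hij, one_apply_ne hij]
      linear_combination (-m i * m' j) * hi
  rw [h, det_mul, det_diagonal, det_one_add_replicateCol_mul_replicateRow, onePlusCleared_eq hδ,
    onePlus, mul_comm]
  congr 2
  exact Finset.sum_congr rfl fun v _ => by rw [dVec]; ring

theorem map_onePlusCleared {S : Type*} [CommRing S] (φ : R →+* S) (m m' : ι → R) :
    onePlusCleared (fun v => φ (m v)) (fun v => φ (m' v)) = φ (onePlusCleared m m') := by
  simp [onePlusCleared]

theorem map_pairSumCleared {S : Type*} [CommRing S] (φ : R →+* S) (m m' : ι → R) :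
    pairSumCleared (fun v => φ (m v)) (fun v => φ (m' v)) = φ (pairSumCleared m m') := by
  simp [pairSumCleared]

end CliqueData

namespace SimpleGraph

open Matrix

variable {V : Type*} {G : SimpleGraph V} {R S : Type*} [CommRing R] [CommRing S]

namespace BlockDatum

theorem map_multDist (φ : R →+* S) {𝒢 : G.BlockDatum R} {ℋ : G.BlockDatum S}
    (hm : ∀ e i j, ℋ.mat e i j = φ (𝒢.mat e i j)) (i j : V) :
    ℋ.multDist i j = φ (𝒢.multDist i j) := by
  induction hn : G.dist i j using Nat.strong_induction_on generalizing i j with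
  | _ n ih =>
  conv_lhs => rw [multDist]
  conv_rhs => rw [multDist]
  split_ifs with h1 h2
  · exact hm _ _ _
  · have hs := h2.choose_spec
    rw [map_mul, ih _ (hn ▸ hs.dist_left_lt) _ _ rfl, ih _ (hn ▸ hs.dist_right_lt) _ _ rfl]
  · exact (map_zero φ).symm

theorem map_addMultDist (φ : R →+* S) {𝒢 : G.BlockDatum R} {ℋ : G.BlockDatum S}
    (ha : ∀ e, ℋ.a e = φ (𝒢.a e)) (hm : ∀ e i j, ℋ.mat e i j = φ (𝒢.mat e i j)) (i j : V) :
    ℋ.addMultDist i j = φ (𝒢.addMultDist i j) := by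
  induction hn : G.dist i j using Nat.strong_induction_on generalizing i j with
  | _ n ih =>
  conv_lhs => rw [addMultDist]
  conv_rhs => rw [addMultDist]
  split_ifs with h1 h2
  · rw [map_mul, map_sub, map_one, ha, hm]
  · have hs := h2.choose_spec
    rw [map_add, map_mul, map_multDist φ hm, ih _ (hn ▸ hs.dist_left_lt) _ _ rfl,
      ih _ (hn ▸ hs.dist_right_lt) _ _ rfl]
  · exact (map_zero φ).symm

theorem map_distMatrix [Fintype V] [DecidableEq V] (φ : R →+* S) {𝒢 : G.BlockDatum R} {ℋ : G.BlockDatum S}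
    (ha : ∀ e, ℋ.a e = φ (𝒢.a e)) (hm : ∀ e i j, ℋ.mat e i j = φ (𝒢.mat e i j)) :
    ℋ.distMatrix = φ.mapMatrix 𝒢.distMatrix := by
  ext i j
  exact map_addMultDist φ ha hm i j

theorem map_kappa [Fintype V] [DecidableEq V] (φ : R →+* S) {𝒢 : G.BlockDatum R}
    {ℋ : G.BlockDatum S} (ha : ∀ e, ℋ.a e = φ (𝒢.a e))
    (hm : ∀ e i j, ℋ.mat e i j = φ (𝒢.mat e i j)) (r : V) :
    ℋ.kappa r = φ (𝒢.kappa r) := by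
  rw [kappa, kappa, RingHom.map_det]
  congr 1
  ext i j
  simp [map_multDist φ hm, map_addMultDist φ ha hm]

end BlockDatum

theorem _root_.Matrix.map_cofactorSum {n : Type*} [Fintype n] [DecidableEq n] (φ : R →+* S)
    (A : Matrix n n R) : (φ.mapMatrix A).cofactorSum = φ A.cofactorSum := by
  simp only [cofactorSum, map_sum, ← RingHom.map_adjugate]
  rfl

variable [Fintype V] [LinearOrder V]

/-- The formulas for `κ`, the determinant and the cofactor sum in the form without
denominators. -/
def ClearedFormulas (a : G.StrongBlock → R) (m m' : ∀ e : G.StrongBlock, e.1 → R) (v₀ : V) :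
    Prop :=
  (BlockDatum.ofCliques a m m').kappa v₀ =
      ∏ e : G.StrongBlock, (a e ^ (e.1.card - 1) * onePlusCleared (m e) (m' e)) ∧
    (BlockDatum.ofCliques a m m').distMatrix.det =
      ∑ e : G.StrongBlock, -a e * (a e ^ (e.1.card - 1) * pairSumCleared (m e) (m' e)) *
        ∏ f : G.StrongBlock with f ≠ e, (a f ^ (f.1.card - 1) * onePlusCleared (m f) (m' f)) ∧
    (BlockDatum.ofCliques a m m').distMatrix.cofactorSum =
      ∏ e : G.StrongBlock, (a e ^ (e.1.card - 1) * onePlusCleared (m e) (m' e)) +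
        ∑ e : G.StrongBlock, (a e ^ (e.1.card - 1) * pairSumCleared (m e) (m' e)) *
          ∏ f : G.StrongBlock with f ≠ e,
            (a f ^ (f.1.card - 1) * onePlusCleared (m f) (m' f))

omit [Fintype V] in
theorem prod_eq_mul_prod_ne [Fintype G.StrongBlock] (F : G.StrongBlock → R) (e : G.StrongBlock) :
    ∏ f, F f = F e * ∏ f with f ≠ e, F f := by
  rw [← Finset.mul_prod_erase _ _ (Finset.mem_univ e)]
  congr 1
  exact Finset.prod_congr (by ext; simp) fun _ _ => rfl

theorem clearedFormulas_of_isUnit (hG : G.IsHypertree) (a : G.StrongBlock → R)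
    (m m' : ∀ e : G.StrongBlock, e.1 → R) (v₀ : V)
    (hδ : ∀ e v, IsUnit (1 - m e v * m' e v)) (h1 : ∀ e, IsUnit (onePlus (m e) (m' e))) :
    ClearedFormulas a m m' v₀ := by
  let 𝒢 := BlockDatum.ofCliques a m m'
  have hM : ∀ e i j, 𝒢.mat e i j = if i = j then 1 else m e i * m' e j := fun e i j => by
    simp [𝒢, BlockDatum.ofCliques]
  have hz : ∀ e, 𝒢.mat e *ᵥ solution (m e) (m' e) = 1 := fun e =>
    mulVec_solution (hδ e) (h1 e) _ (hM e)
  have hdet : ∀ e, (𝒢.mat e).det = onePlusCleared (m e) (m' e) := fun e =>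
    det_eq_onePlusCleared (hδ e) _ (hM e)
  have hQ : ∀ e, onePlusCleared (m e) (m' e) * (∑ v, solution (m e) (m' e) v - 1) =
      pairSumCleared (m e) (m' e) := fun e => by
    rw [onePlusCleared_eq (hδ e), pairSumCleared_eq (hδ e),
      ← onePlus_mul_sum_solution (hδ e) (h1 e)]
    ring
  have ha : 𝒢.a = a := rfl
  have hκ := 𝒢.kappa_eq hG hz v₀
  have hd := 𝒢.det_distMatrix hG hz
  have hc := 𝒢.cofactorSum_distMatrix hG hz
  simp only [hdet, ha] at hκ hd hc
  refine ⟨hκ, ?_, ?_⟩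
  · rw [hd, Finset.mul_sum]
    refine Finset.sum_congr rfl fun e _ => ?_
    rw [prod_eq_mul_prod_ne _ e, ← hQ]
    ring
  · rw [hc, mul_add, mul_one, Finset.mul_sum]
    congr 1
    refine Finset.sum_congr rfl fun e _ => ?_
    rw [prod_eq_mul_prod_ne _ e, ← hQ]
    ring

theorem clearedFormulas_map_iff (φ : R →+* S) (a : G.StrongBlock → R)
    (m m' : ∀ e : G.StrongBlock, e.1 → R) (v₀ : V) :
    ClearedFormulas (fun e => φ (a e)) (fun e v => φ (m e v)) (fun e v => φ (m' e v)) v₀ ↔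
      φ ((BlockDatum.ofCliques a m m').kappa v₀) = φ
          (∏ e : G.StrongBlock, (a e ^ (e.1.card - 1) * onePlusCleared (m e) (m' e))) ∧
      φ (BlockDatum.ofCliques a m m').distMatrix.det = φ
          (∑ e : G.StrongBlock, -a e * (a e ^ (e.1.card - 1) * pairSumCleared (m e) (m' e)) *
            ∏ f : G.StrongBlock with f ≠ e,
              (a f ^ (f.1.card - 1) * onePlusCleared (m f) (m' f))) ∧
      φ (BlockDatum.ofCliques a m m').distMatrix.cofactorSum = φ
          (∏ e : G.StrongBlock, (a e ^ (e.1.card - 1) * onePlusCleared (m e) (m' e)) +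
            ∑ e : G.StrongBlock, (a e ^ (e.1.card - 1) * pairSumCleared (m e) (m' e)) *
              ∏ f : G.StrongBlock with f ≠ e,
                (a f ^ (f.1.card - 1) * onePlusCleared (m f) (m' f))) := by
  have ha : ∀ e, (BlockDatum.ofCliques (G := G) (fun e => φ (a e)) (fun e v => φ (m e v))
      (fun e v => φ (m' e v))).a e = φ ((BlockDatum.ofCliques a m m').a e) := fun e => rfl
  have hm : ∀ e i j, (BlockDatum.ofCliques (G := G) (fun e => φ (a e)) (fun e v => φ (m e v))
      (fun e v => φ (m' e v))).mat e i j = φ ((BlockDatum.ofCliques a m m').mat e i j) := by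
    intro e i j
    simp only [BlockDatum.ofCliques, of_apply]
    split_ifs <;> simp
  rw [ClearedFormulas, BlockDatum.map_kappa φ ha hm, BlockDatum.map_distMatrix φ ha hm,
    ← RingHom.map_det, map_cofactorSum]
  simp only [map_onePlusCleared, map_pairSumCleared, map_sum, map_prod, map_mul, map_add,
    map_neg, map_pow]

/-- Multiplying all `m e v` by an indeterminate makes all denominators units of the ring of power
series. -/
theorem clearedFormulas (hG : G.IsHypertree) (a : G.StrongBlock → R)
    (m m' : ∀ e : G.StrongBlock, e.1 → R) (v₀ : V) : ClearedFormulas a m m' v₀ := by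
  let a₁ : G.StrongBlock → Polynomial R := fun e => Polynomial.C (a e)
  let m₁ : ∀ e : G.StrongBlock, e.1 → Polynomial R := fun e v => Polynomial.X * Polynomial.C (m e v)
  let m₁' : ∀ e : G.StrongBlock, e.1 → Polynomial R := fun e v => Polynomial.C (m' e v)
  let φ : Polynomial R →+* PowerSeries R := Polynomial.coeToPowerSeries.ringHom
  have hδ : ∀ e v, IsUnit (1 - φ (m₁ e v) * φ (m₁' e v)) := fun e v => by
    rw [PowerSeries.isUnit_iff_constantCoeff]
    simp [φ, m₁, m₁']
  have h1 : ∀ e, IsUnit (onePlus (fun v => φ (m₁ e v)) (fun v => φ (m₁' e v))) := fun e => by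
    have h : IsUnit (onePlusCleared (fun v => φ (m₁ e v)) (fun v => φ (m₁' e v))) := by
      rw [PowerSeries.isUnit_iff_constantCoeff]
      simp [onePlusCleared, φ, m₁, m₁']
    rw [onePlusCleared_eq (hδ e)] at h
    exact isUnit_of_mul_isUnit_left h
  have hφ : Function.Injective φ := Polynomial.coe_injective R
  have hS := (clearedFormulas_map_iff φ a₁ m₁ m₁' v₀).1
    (clearedFormulas_of_isUnit hG _ _ _ v₀ hδ h1)
  have hR := (clearedFormulas_map_iff (Polynomial.evalRingHom 1) a₁ m₁ m₁' v₀).2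
    ⟨congrArg _ (hφ hS.1), congrArg _ (hφ hS.2.1), congrArg _ (hφ hS.2.2)⟩
  simpa [a₁, m₁, m₁'] using hR

end SimpleGraph

theorem mainTheorem6 {V : Type*} [Fintype V] [LinearOrder V] {R : Type*} [CommRing R]
    (G : SimpleGraph V) (hG : G.IsHypertree) (a : G.StrongBlock → R)
    (m m' : ∀ e : G.StrongBlock, e.1 → R) (v₀ : V) :
    let 𝒢 := BlockDatum.ofCliques a m m'
    let κ := 𝒢.kappa v₀
    let D := 𝒢.distMatrix
    -- the formulas as they stand, whenever the denominators are units
    ((∀ e v, IsUnit (1 - m e v * m' e v)) →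
      κ = ∏ e : G.StrongBlock, (a e ^ (e.1.card - 1) * onePlus (m e) (m' e) *
            ∏ v : e.1, (1 - m e v * m' e v)) ∧
      ((∀ e, IsUnit (onePlus (m e) (m' e))) →
        D.det = κ * ∑ e : G.StrongBlock,
          -a e * Ring.inverse (onePlus (m e) (m' e)) * pairSum (m e) (m' e) ∧
        D.cofactorSum = κ * (1 + ∑ e : G.StrongBlock,
          Ring.inverse (onePlus (m e) (m' e)) * pairSum (m e) (m' e)))) ∧
    -- the formulas after cancelling the denominators, for all values of the data
    (κ = ∏ e : G.StrongBlock, (a e ^ (e.1.card - 1) * onePlusCleared (m e) (m' e)) ∧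
      D.det = ∑ e : G.StrongBlock, -a e * (a e ^ (e.1.card - 1) * pairSumCleared (m e) (m' e)) *
        ∏ f : G.StrongBlock with f ≠ e, (a f ^ (f.1.card - 1) * onePlusCleared (m f) (m' f)) ∧
      D.cofactorSum = ∏ e : G.StrongBlock, (a e ^ (e.1.card - 1) * onePlusCleared (m e) (m' e)) +
        ∑ e : G.StrongBlock, (a e ^ (e.1.card - 1) * pairSumCleared (m e) (m' e)) *
          ∏ f : G.StrongBlock with f ≠ e,
            (a f ^ (f.1.card - 1) * onePlusCleared (m f) (m' f))) := by
  intro 𝒢 κ D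
  have hcl := clearedFormulas hG a m m' v₀
  refine ⟨fun hδ => ?_, hcl⟩
  obtain ⟨hκ, hd, hc⟩ := hcl
  refine ⟨?_, fun h1 => ?_⟩
  · simp only [onePlusCleared_eq (hδ _), ← mul_assoc] at hκ
    exact hκ
  · have key : ∀ e : G.StrongBlock, (a e ^ (e.1.card - 1) * pairSumCleared (m e) (m' e)) *
        ∏ f : G.StrongBlock with f ≠ e, (a f ^ (f.1.card - 1) * onePlusCleared (m f) (m' f)) =
        κ * (Ring.inverse (onePlus (m e) (m' e)) * pairSum (m e) (m' e)) := by
      intro e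
      have hκ' : κ = _ := hκ
      rw [hκ', prod_eq_mul_prod_ne _ e, pairSumCleared_eq (hδ e)]
      conv_rhs => rw [onePlusCleared_eq (hδ e)]
      linear_combination (-(a e ^ (e.1.card - 1) * pairSum (m e) (m' e) *
        (∏ v, (1 - m e v * m' e v)) * ∏ f : G.StrongBlock with f ≠ e,
          (a f ^ (f.1.card - 1) * onePlusCleared (m f) (m' f)))) *
        Ring.mul_inverse_cancel _ (h1 e)
    constructor
    · refine hd.trans ?_
      rw [Finset.mul_sum]
      refine Finset.sum_congr rfl fun e _ => ?_
      rw [mul_assoc, key]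
      ring
    · refine hc.trans ?_
      rw [mul_add, mul_one, Finset.mul_sum, ← hκ]
      exact congrArg _ (Finset.sum_congr rfl fun e _ => key e)
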